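/- Fix an integer $N\ge 1$. The $3N$-gasket $K$ is the quotient of the space of infinite words over $\{1,\dots,3N\}$ by the equivalence relation generated by $w\,i\,(2N)\,\overline N\sim w\,j\,(3N)\,\overline N$ for all finite words $w$ and all letters $i\equiv j+1 \pmod{3N}$, where $\overline N=NNN\cdots$. Let $F_i:K\to K$ be induced by putting the letter $i$ in front of a word, let $V_0=\{v_1,v_2,v_3\}$, where $v_k$ is the class of $(kN)\overline N$, and let $V_{n+1}=\bigcup_{i=1}^{3N}F_i(V_n)\supseteq V_n$. Distinct $x,y\in V_n$ are adjacent, $x\sim y$, if $x,y\in F_{i_1}\circ\cdots\circ F_{i_n}(V_0)$ for some word $i_1\cdots i_n$. Let $\Delta_nf(x)=f(x)-\frac1{d_x}\sum_{y\sim x}f(y)$ for functions $f$ on $V_n$, where $d_x$ is the degree of $x$. Write $$\Delta_{n+1}-z=\begin{pmatrix}A-z&B\\ C&D-z\end{pmatrix},$$ where $A$ is the block of the vertices in $V_n$, and let $S(z)=S_n(z)=(A-z)-B(D-z)^{-1}C$ be the Schur complement. There are rational functions $R$ and $\phi$ over $\mathbb C$, depending only on $N$, such that for every $n\ge 0$ they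 form the unique pair of rational functions with $$S_n(z)=\phi(z)\,(\Delta_n-R(z))$$ at every $z\in\mathbb C$ for which $D-z$ is invertible and which is not a pole of $R$ or of $\phi$. Let $T_k$ and $U_k$ be the Chebyshev polynomials of the first and second kind, and let $G(z)=2T_N(1-2z)+2U_{N-1}(1-2z)+1$. If $N$ is even, then $$R(z)=\frac{(z-1)\sqrt z\,U_{N-1}(\sqrt z)\,G(z)}{T_N(\sqrt z)},\qquad \phi(z)=\frac{(3-2z)\,T_N(\sqrt z)}{\bigl(T_N(\sqrt z)-2(z-1)\sqrt z\,U_{N-1}(\sqrt z)\bigr)\,G(z)},$$ and if $N$ is odd, then $$R(z)=\frac{\sqrt z\,T_N(\sqrt z)\,G(z)}{U_{N-1}(\sqrt z)},\qquad \phi(z)=\frac{(3-2z)\,U_{N-1}(\sqrt z)}{\bigl(U_{N-1}(\sqrt z)-2\sqrt z\,T_N(\sqrt z)\bigr)\,G(z)}.$$ Further, let $N>1$. Then the poles of $R$ in $\mathbb C$ are exactly the points $\cos^2\!\left(\frac{m\pi}{2N}\right)$ with $m=1,3,\dots,N-1$ if $N$ is even, and with $m=2,4,\dots,N-1$ if $N$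 is odd, and all of them are simple. These points together with $3/2$ are exactly the zeros of $\phi$ in $\mathbb C$. -/

import Mathlib

namespace Gasket

/-- The alphabet `{1, …, 3N}`, read as the residues modulo `3N`. -/
abbrev Letter (N : ℕ) : Type := ZMod (3 * N)

/-- The generating identifications on the shift space of infinite words: for every finite word `w`
and all letters `i = j + 1` (modulo `3N`), the infinite words `w i (2N) N N N …` and
`w j (3N) N N N …` are identified. -/
inductive Glue (N : ℕ) : Stream' (Letter N) → Stream' (Letter N) → Prop
  | base (i j : Letter N) (h : i = j + 1) :
      Glue N (Stream'.cons i (Stream'.cons ((2 * N : ℕ) : Letter N) (Stream'.const (N : Letter N))))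
        (Stream'.cons j (Stream'.cons ((3 * N : ℕ) : Letter N) (Stream'.const (N : Letter N))))
  | cons (k : Letter N) {x y : Stream' (Letter N)} (h : Glue N x y) :
      Glue N (Stream'.cons k x) (Stream'.cons k y)

/-- The `3N`-gasket `K`: the quotient of the shift space by the equivalence relation generated by
`Glue`. -/
def K (N : ℕ) : Type := Quot (Glue N)

/-- The coding map `π`. -/
def proj (N : ℕ) : Stream' (Letter N) → K N := Quot.mk (Glue N)

/-- The map `F_i : K → K`, induced by putting the letter `i` in front of a word. -/
def F (N : ℕ) (i : Letter N) : K N → K N :=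
  Quot.map (Stream'.cons i) (fun _ _ h => Glue.cons i h)

/-- `F_w = F_{i₁} ∘ ⋯ ∘ F_{iₙ}` for a finite word `w = i₁ ⋯ iₙ`. -/
def Fword (N : ℕ) (w : List (Letter N)) : K N → K N :=
  w.foldr (fun i f => F N i ∘ f) id

/-- The boundary point `v_k = F_{kN}(v_1)`, i.e. `π((kN) N N N …)`, for `k = 1, 2, 3`. -/
def bdry (N k : ℕ) : K N :=
  proj N (Stream'.cons ((k * N : ℕ) : Letter N) (Stream'.const (N : Letter N)))

/-- The vertex sets: `V_0 = {v_1, v_2, v_3}` and `V_{n+1} = ⋃ i, F_i (V_n)`. -/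
def V (N : ℕ) : ℕ → Set (K N)
  | 0 => {bdry N 1, bdry N 2, bdry N 3}
  | n + 1 => ⋃ i : Letter N, F N i '' V N n

theorem bdry_one (N : ℕ) : bdry N 1 = proj N (Stream'.const (N : Letter N)) := by
  unfold bdry
  rw [one_mul, ← Stream'.const_eq]

theorem F_bdry_one (N k : ℕ) : F N ((k * N : ℕ) : Letter N) (bdry N 1) = bdry N k := by
  rw [bdry_one]
  rfl

/-- The identifications `F_i(v_2) = F_j(v_3)` for `i = j + 1` modulo `3N`. -/
theorem F_glue (N : ℕ) (i j : Letter N) (h : i = j + 1) :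
    F N i (bdry N 2) = F N j (bdry N 3) :=
  Quot.sound (Glue.base i j h)

theorem V_subset_succ (N n : ℕ) : V N n ⊆ V N (n + 1) := by
  induction n with
  | zero =>
    have key : ∀ k : ℕ, bdry N k ∈ V N 1 := fun k =>
      Set.mem_iUnion.2 ⟨((k * N : ℕ) : Letter N), bdry N 1, Or.inl rfl, F_bdry_one N k⟩
    rintro x (rfl | rfl | rfl)
    · exact key 1
    · exact key 2
    · exact key 3
  | succ n ih => exact Set.iUnion_mono fun i => Set.image_mono ih

theorem V_finite (N : ℕ) [NeZero N] (n : ℕ) : (V N n).Finite := by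
  induction n with
  | zero => exact ((Set.finite_singleton _).insert _).insert _
  | succ n ih => exact Set.finite_iUnion fun i => ih.image _

noncomputable instance (N : ℕ) [NeZero N] (n : ℕ) : Fintype (V N n) := (V_finite N n).fintype

noncomputable instance (N : ℕ) [NeZero N] (n : ℕ) : Fintype ↥(V N (n + 1) \ V N n) :=
  (V_finite N (n + 1)).sdiff.fintype

/-- The `n`-th approximating graph: distinct `x, y ∈ V_n` are adjacent if both lie in `F_w(V_0)`
for some word `w` of length `n`. -/
def graph (N n : ℕ) : SimpleGraph (V N n) where
  Adj x y := x ≠ y ∧ ∃ w : List (Letter N), w.length = n ∧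
    (x : K N) ∈ Fword N w '' V N 0 ∧ (y : K N) ∈ Fword N w '' V N 0
  symm := ⟨fun _ _ h => ⟨h.1.symm, h.2.imp fun _ hw => ⟨hw.1, hw.2.2, hw.2.1⟩⟩⟩
  loopless := ⟨fun _ h => h.1 rfl⟩

open Classical in
/-- The matrix of the probabilistic graph Laplacian `Δ_n` on `V_n`. -/
noncomputable def lap (N : ℕ) [NeZero N] (n : ℕ) : Matrix (V N n) (V N n) ℂ :=
  fun x y => (if x = y then 1 else 0) -
    (if (graph N n).Adj x y then ((graph N n).degree x : ℂ)⁻¹ else 0)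

open Classical in
/-- `Δ_n f (x) = f x - (1 / d_x) ∑_{y ∼ x} f y`. -/
theorem lap_mulVec (N : ℕ) [NeZero N] (n : ℕ) (f : V N n → ℂ) (x : V N n) :
    (lap N n).mulVec f x =
      f x - 1 / ((graph N n).degree x : ℂ) * ∑ y ∈ (graph N n).neighborFinset x, f y := by
  simp only [Matrix.mulVec, dotProduct, lap, sub_mul, Finset.sum_sub_distrib, ite_mul, one_mul,
    zero_mul, Finset.sum_ite_eq, Finset.mem_univ, if_true, one_div, Finset.mul_sum]
  rw [← Finset.sum_filter, SimpleGraph.neighborFinset_eq_filter]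

/-- The inclusion `V_n → V_{n+1}`. -/
def old (N n : ℕ) : V N n → V N (n + 1) := Set.inclusion (V_subset_succ N n)

/-- The inclusion `V_{n+1} \ V_n → V_{n+1}`. -/
def new (N n : ℕ) : ↥(V N (n + 1) \ V N n) → V N (n + 1) := Set.inclusion Set.sdiff_subset

open Classical in
/-- The matrix `Δ_{n+1} - z`. -/
noncomputable def shifted (N : ℕ) [NeZero N] (n : ℕ) (z : ℂ) :
    Matrix (V N (n + 1)) (V N (n + 1)) ℂ :=
  lap N (n + 1) - z • 1

/-- The block `D - z` of `Δ_{n+1} - z`, on the vertices of `V_{n+1}` outside `V_n`. -/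
noncomputable def blockD (N : ℕ) [NeZero N] (n : ℕ) (z : ℂ) :
    Matrix ↥(V N (n + 1) \ V N n) ↥(V N (n + 1) \ V N n) ℂ :=
  (shifted N n z).submatrix (new N n) (new N n)

open Classical in
/-- The Schur complement `S(z) = (A - z) - B (D - z)⁻¹ C` of
`Δ_{n+1} - z = (A - z, B; C, D - z)`, where `A` is the block of the vertices in `V_n`. -/
noncomputable def schur (N : ℕ) [NeZero N] (n : ℕ) (z : ℂ) : Matrix (V N n) (V N n) ℂ :=
  (shifted N n z).submatrix (old N n) (old N n) -
    (shifted N n z).submatrix (old N n) (new N n) * (blockD N n z)⁻¹ *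
      (shifted N n z).submatrix (new N n) (old N n)

/-- `c` is a pole of the rational function `R` (in lowest terms). -/
def IsPole (R : RatFunc ℂ) (c : ℂ) : Prop := R.denom.IsRoot c

/-- `c` is a simple pole of the rational function `R`. -/
def IsSimplePole (R : RatFunc ℂ) (c : ℂ) : Prop := R.denom.rootMultiplicity c = 1

/-- `c` is a zero of the rational function `R` (in lowest terms). -/
def IsZero (R : RatFunc ℂ) (c : ℂ) : Prop := R.num.IsRoot c

open Classical in
/-- The rational functions `R, φ` satisfy `S(z) = φ(z) (Δ_n - R(z))`, as matrix-valued rational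
functions: at every `z` where `S(z)`, `R(z)` and `φ(z)` are defined. -/
def IsDecimationPair (N : ℕ) [NeZero N] (n : ℕ) (R φ : RatFunc ℂ) : Prop :=
  ∀ z : ℂ, IsUnit (blockD N n z).det → ¬ IsPole R z → ¬ IsPole φ z →
    schur N n z = φ.eval (RingHom.id ℂ) z • (lap N n - R.eval (RingHom.id ℂ) z • 1)

/-- For a rational function `R(z)`, the rational function `R(w²)` of `w`. -/
noncomputable def atSq (R : RatFunc ℂ) : RatFunc ℂ :=
  R.eval (RatFunc.C : ℂ →+* RatFunc ℂ) (RatFunc.X ^ 2)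

/-- The Chebyshev polynomial of the first kind, evaluated at a rational function. -/
noncomputable def chebT (k : ℤ) (x : RatFunc ℂ) : RatFunc ℂ :=
  (Polynomial.Chebyshev.T (RatFunc ℂ) k).eval x

/-- The Chebyshev polynomial of the second kind, evaluated at a rational function. -/
noncomputable def chebU (k : ℤ) (x : RatFunc ℂ) : RatFunc ℂ :=
  (Polynomial.Chebyshev.U (RatFunc ℂ) k).eval x

/-- The right-hand side of the formula for `R(z)`, as a rational function of `w = √z`. -/
noncomputable def formulaR (N : ℕ) : RatFunc ℂ :=
  let w : RatFunc ℂ := RatFunc.X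
  let z : RatFunc ℂ := w ^ 2
  if Even N then
    ((z - 1) * w * chebU (N - 1) w * (2 * chebT N (1 - 2 * z) + 2 * chebU (N - 1) (1 - 2 * z) + 1))
      / chebT N w
  else
    (w * chebT N w * (2 * chebT N (1 - 2 * z) + 2 * chebU (N - 1) (1 - 2 * z) + 1))
      / chebU (N - 1) w

/-- The right-hand side of the formula for `φ(z)`, as a rational function of `w = √z`. -/
noncomputable def formulaPhi (N : ℕ) : RatFunc ℂ :=
  let w : RatFunc ℂ := RatFunc.X
  let z : RatFunc ℂ := w ^ 2
  if Even N then
    ((3 - 2 * z) * chebT N w) /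
      ((chebT N w - 2 * (z - 1) * w * chebU (N - 1) w) *
        (2 * chebT N (1 - 2 * z) + 2 * chebU (N - 1) (1 - 2 * z) + 1))
  else
    ((3 - 2 * z) * chebU (N - 1) w) /
      ((chebU (N - 1) w - 2 * w * chebT N w) *
        (2 * chebT N (1 - 2 * z) + 2 * chebU (N - 1) (1 - 2 * z) + 1))

/-- The points `cos² (m π / (2N))`, with `m = 1, 3, …, N - 1` for even `N` and
`m = 2, 4, …, N - 1` for odd `N`. -/
noncomputable def poleSet (N : ℕ) : Set ℂ :=
  {c | ∃ m : ℕ, 1 ≤ m ∧ m < N ∧ (Even N → Odd m) ∧ (Odd N → Even m) ∧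
    c = ((Real.cos (m * Real.pi / (2 * N)) ^ 2 : ℝ) : ℂ)}

end Gasket

/-! Refining level `n` to level `n + 1` replaces each `n`-cell by a ring of `3N` triangles, and
distinct `n`-cells meet only in boundary points. At a point of `V_n` equally many cells meet on both
levels, so `Δ_n` and `Δ_{n+1}` average local Laplacians with the same weights there
(`card_mul_lap_mulVec`, `card_corners_succ`). The Schur complement is therefore governed by a
boundary value problem on a single ring, `HasLocalExtension`, which does not involve `n`. It
suffices to exhibit one solution of it: invertibility of `D - z` makes the glued extension the right
one (`schur_mulVec`, `schur_eq`).

Put `c = 1 - 2z`, `t = T_N(c)`, `u = U_{N-1}(c)`, `G = 2t + 2u + 1`. Eliminating the outer vertices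
leaves `2c X_i - X_{i-1} - X_{i+1} = source` on the cycle `ℤ/3N`, with sources only beside the three
corner letters. A Green function built from Chebyshev polynomials solves it. By rotation and
reflection symmetry the remaining 3 × 3 system has the form `x I + y J`, with `J` the all-ones
matrix. Inverting it gives `R = (1 - t) G / (2u)` and `φ = (3 - 2z) u / ((u + t - 1) G)`
(`hasLocalExtension_of_ne`). Writing `z = cos² θ` halves the angle and turns `(1 - t) / (2u)` into
`p / q`, whose parity-dependent shape is that of the stated formulas (`two_mul_u_mul_p`).

All this holds off a finite set of `z`; continuity gives the identity wherever both sides are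
defined, and two matrix entries determine the pair. For the poles, `t = -1`, `u = 0` and hence `G =
-1` at each root of `q`, so nothing cancels there. At `z = 3/2` the Chebyshev argument is `-2`,
where integer recursions exclude cancellation. -/

namespace Gasket

/-! ### Codes of boundary points and coincidences `F_i x = F_j y` -/

/-- The boundary points `v_1, v_2, v_3`, indexed by `Fin 3`. -/
def corner (N : ℕ) (a : Fin 3) : K N := bdry N (a.val + 1)

/-- The letter `(a + 1) N` whose cell contains the boundary point `corner N a`. -/
def cornerLetter (N : ℕ) (a : Fin 3) : Letter N := (((a.val + 1) * N : ℕ) : Letter N)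

theorem cornerLetter_injective (N : ℕ) [NeZero N] : Function.Injective (cornerLetter N) := by
  have hN : 0 < N := Nat.pos_of_ne_zero (NeZero.ne N)
  intro a b h
  unfold cornerLetter at h
  rw [ZMod.natCast_eq_natCast_iff'] at h
  have e1 : N % (3 * N) = N := Nat.mod_eq_of_lt (by omega)
  have e2 : (2 * N) % (3 * N) = 2 * N := Nat.mod_eq_of_lt (by omega)
  have e3 : (3 * N) % (3 * N) = 0 := Nat.mod_self _
  fin_cases a <;> fin_cases b <;> simp [e1, e2] at h ⊢ <;> omega

theorem cornerLetter_zero (N : ℕ) : cornerLetter N 0 = (N : Letter N) := by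
  simp [cornerLetter]

theorem cornerLetter_one (N : ℕ) : cornerLetter N 1 = ((2 * N : ℕ) : Letter N) := rfl

theorem cornerLetter_two (N : ℕ) : cornerLetter N 2 = ((3 * N : ℕ) : Letter N) := rfl

theorem corner_eq_proj (N : ℕ) (a : Fin 3) :
    corner N a = proj N (Stream'.cons (cornerLetter N a) (Stream'.const (N : Letter N))) := rfl

theorem F_corner_zero (N : ℕ) (a : Fin 3) : F N (cornerLetter N a) (corner N 0) = corner N a :=
  F_bdry_one N (a.val + 1)

theorem exists_proj_eq (N : ℕ) (x : K N) : ∃ s, proj N s = x := Quot.exists_rep x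

/-- A generating identification puts `2N` or `3N` before the constant tail, at the second place or
later, and neither letter is `N` modulo `3N`. Hence the codes `(kN) N N N …` are identified with
nothing else, and boundary points have a single code. -/
theorem Glue.tail_ne_const {N : ℕ} [NeZero N] {x y : Stream' (Letter N)} (h : Glue N x y) :
    x.tail ≠ Stream'.const (N : Letter N) ∧ y.tail ≠ Stream'.const (N : Letter N) := by
  induction h with
  | base i j h =>
    constructor <;> intro h <;> rw [Stream'.tail_cons] at h <;>
      have h := congrArg Stream'.head h <;> rw [Stream'.head_cons] at h
    · exact absurd (cornerLetter_injective N (a₁ := 1) (a₂ := 0)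
        (by rw [cornerLetter_zero, cornerLetter_one]; exact h)) (by decide)
    · exact absurd (cornerLetter_injective N (a₁ := 2) (a₂ := 0)
        (by rw [cornerLetter_zero, cornerLetter_two]; exact h)) (by decide)
  | cons k h ih =>
    rw [Stream'.tail_cons, Stream'.tail_cons]
    constructor
    · rintro rfl
      exact ih.1 (Stream'.tail_const _)
    · rintro rfl
      exact ih.2 (Stream'.tail_const _)

theorem eq_or_tail_ne_const_of_eqvGen {N : ℕ} [NeZero N] {x y : Stream' (Letter N)}
    (h : Relation.EqvGen (Glue N) x y) :
    x = y ∨ (x.tail ≠ Stream'.const (N : Letter N) ∧ y.tail ≠ Stream'.const (N : Letter N)) := by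
  induction h with
  | rel _ _ h => exact Or.inr h.tail_ne_const
  | refl => exact Or.inl rfl
  | symm _ _ _ ih => exact ih.imp Eq.symm And.symm
  | trans x y z _ _ ih1 ih2 =>
    rcases ih1 with rfl | ih1
    · exact ih2
    · rcases ih2 with rfl | ih2
      · exact Or.inr ih1
      · exact Or.inr ⟨ih1.1, ih2.2⟩

theorem proj_eq_corner_iff {N : ℕ} [NeZero N] {s : Stream' (Letter N)} {a : Fin 3} :
    proj N s = corner N a ↔
      s = Stream'.cons (cornerLetter N a) (Stream'.const (N : Letter N)) := by
  refine ⟨fun h => ?_, fun h => h ▸ rfl⟩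
  rcases eq_or_tail_ne_const_of_eqvGen (Quot.eqvGen_exact h) with h | h
  · exact h
  · exact absurd (Stream'.tail_cons _ _) h.2

theorem corner_injective (N : ℕ) [NeZero N] : Function.Injective (corner N) := by
  intro a b h
  rw [corner_eq_proj, proj_eq_corner_iff] at h
  exact cornerLetter_injective N (Stream'.cons_injective2 h).1

/-- Equality of points `F_i x` and `F_j y` in terms of `i, j, x, y`. -/
def SameImage (N : ℕ) (i j : Letter N) (x y : K N) : Prop :=
  (i = j ∧ x = y) ∨ (i = j + 1 ∧ x = corner N 1 ∧ y = corner N 2) ∨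
    (j = i + 1 ∧ x = corner N 2 ∧ y = corner N 1)

/-- The generators satisfy `SameImage`, and `SameImage` is already an equivalence relation. Two
successive crossings between neighbouring letters either cancel or would force `v_2 = v_3`, so
chains of identifications produce nothing new. -/
theorem sameImage_of_eqvGen {N : ℕ} [NeZero N] {s t : Stream' (Letter N)}
    (h : Relation.EqvGen (Glue N) s t) :
    SameImage N s.head t.head (proj N s.tail) (proj N t.tail) := by
  have h12 : corner N 1 ≠ corner N 2 := fun h => absurd (corner_injective N h) (by decide)
  induction h with
  | rel _ _ h =>
    cases h with
    | base i j h => exact Or.inr (Or.inl ⟨h, rfl, rfl⟩)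
    | cons k h => exact Or.inl ⟨rfl, Quot.sound h⟩
  | refl => exact Or.inl ⟨rfl, rfl⟩
  | symm _ _ _ ih =>
    rcases ih with ⟨h1, h2⟩ | ⟨h1, h2, h3⟩ | ⟨h1, h2, h3⟩
    · exact Or.inl ⟨h1.symm, h2.symm⟩
    · exact Or.inr (Or.inr ⟨h1, h3, h2⟩)
    · exact Or.inr (Or.inl ⟨h1, h3, h2⟩)
  | trans x y z _ _ ih1 ih2 =>
    rcases ih1 with ⟨h1, h2⟩ | ⟨h1, h2, h3⟩ | ⟨h1, h2, h3⟩
    · rw [h1, h2]; exact ih2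
    · rcases ih2 with ⟨k1, k2⟩ | ⟨k1, k2, k3⟩ | ⟨k1, k2, k3⟩
      · exact Or.inr (Or.inl ⟨h1.trans (by rw [k1]), h2, k2.symm.trans h3⟩)
      · exact absurd (k2.symm.trans h3) h12
      · exact Or.inl ⟨h1.trans k1.symm, h2.trans k3.symm⟩
    · rcases ih2 with ⟨k1, k2⟩ | ⟨k1, k2, k3⟩ | ⟨k1, k2, k3⟩
      · exact Or.inr (Or.inr ⟨k1.symm.trans h1, h2, k2.symm.trans h3⟩)
      · exact Or.inl ⟨add_right_cancel (h1.symm.trans k1), h2.trans k3.symm⟩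
      · exact absurd (h3.symm.trans k2) h12

theorem F_eq_iff {N : ℕ} [NeZero N] {i j : Letter N} {x y : K N} :
    F N i x = F N j y ↔ SameImage N i j x y := by
  constructor
  · obtain ⟨s, rfl⟩ := exists_proj_eq N x
    obtain ⟨t, rfl⟩ := exists_proj_eq N y
    intro h
    exact sameImage_of_eqvGen (Quot.eqvGen_exact h)
  · rintro (⟨rfl, rfl⟩ | ⟨h, rfl, rfl⟩ | ⟨h, rfl, rfl⟩)
    · rfl
    · exact F_glue N i j h
    · exact (F_glue N j i h).symm

theorem letter_ne_add_one {N : ℕ} [NeZero N] (i : Letter N) : i ≠ i + 1 := by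
  have : Fact (1 < 3 * N) := ⟨by have := NeZero.pos N; omega⟩
  intro h
  exact one_ne_zero (left_eq_add.1 h)

/-- This uses `3N ≥ 3`. Otherwise two cells could be neighbours in both directions of the ring and
share two points. -/
theorem letter_ne_add_two {N : ℕ} [NeZero N] (i : Letter N) : i ≠ i + 1 + 1 := by
  have hN := NeZero.pos N
  intro h
  rw [add_assoc] at h
  have h2 : ((2 : ℕ) : Letter N) = ((0 : ℕ) : Letter N) := by
    have := left_eq_add.1 h
    push_cast
    rw [← this]; norm_num
  rw [ZMod.natCast_eq_natCast_iff', Nat.zero_mod, Nat.mod_eq_of_lt (by omega)] at h2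
  omega

theorem F_injective (N : ℕ) [NeZero N] (i : Letter N) : Function.Injective (F N i) := by
  intro x y h
  rcases F_eq_iff.1 h with h | h | h
  · exact h.2
  · exact absurd h.1 (letter_ne_add_one i)
  · exact absurd h.1 (letter_ne_add_one i)

theorem F_eq_corner_iff {N : ℕ} [NeZero N] {i : Letter N} {x : K N} {a : Fin 3} :
    F N i x = corner N a ↔ i = cornerLetter N a ∧ x = corner N 0 := by
  rw [← F_corner_zero N a, F_eq_iff]
  have h1 : corner N 0 ≠ corner N 1 := fun h => absurd (corner_injective N h) (by decide)
  have h2 : corner N 0 ≠ corner N 2 := fun h => absurd (corner_injective N h) (by decide)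
  simp [SameImage, h1, h2]

theorem F_corner_one (N : ℕ) (i : Letter N) : F N (i + 1) (corner N 1) = F N i (corner N 2) :=
  F_glue N _ _ rfl

/-! ### Cells `F_w(K)` and their intersections -/

theorem Fword_cons (N : ℕ) (i : Letter N) (w : List (Letter N)) (x : K N) :
    Fword N (i :: w) x = F N i (Fword N w x) := rfl

theorem Fword_concat (N : ℕ) (w : List (Letter N)) (i : Letter N) (x : K N) :
    Fword N (w ++ [i]) x = Fword N w (F N i x) := by
  induction w with
  | nil => rfl
  | cons j w ih => rw [List.cons_append, Fword_cons, Fword_cons, ih]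

theorem Fword_injective (N : ℕ) [NeZero N] (w : List (Letter N)) :
    Function.Injective (Fword N w) := by
  induction w with
  | nil => exact fun _ _ h => h
  | cons i w ih => exact (F_injective N i).comp ih

theorem mem_V_zero {N : ℕ} {x : K N} : x ∈ V N 0 ↔ ∃ a, x = corner N a := by
  simp only [V, Set.mem_insert_iff, Set.mem_singleton_iff, Fin.exists_fin_succ, corner]
  simp

theorem mem_V_iff {N n : ℕ} {x : K N} :
    x ∈ V N n ↔ ∃ w : List (Letter N), w.length = n ∧ ∃ a, x = Fword N w (corner N a) := by
  induction n generalizing x with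
  | zero =>
    rw [mem_V_zero]
    constructor
    · rintro ⟨a, h⟩; exact ⟨[], rfl, a, h⟩
    · rintro ⟨w, hw, a, h⟩
      obtain rfl := List.length_eq_zero_iff.1 hw
      exact ⟨a, h⟩
  | succ n ih =>
    simp only [V, Set.mem_iUnion, Set.mem_image]
    constructor
    · rintro ⟨i, y, hy, rfl⟩
      obtain ⟨w, hw, a, rfl⟩ := ih.1 hy
      exact ⟨i :: w, by simp [hw], a, rfl⟩
    · rintro ⟨w, hw, a, rfl⟩
      cases w with
      | nil => simp at hw
      | cons i w => exact ⟨i, _, ih.2 ⟨w, by simpa using hw, a, rfl⟩, rfl⟩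

theorem mem_V_succ_iff {N n : ℕ} {x : K N} :
    x ∈ V N (n + 1) ↔ ∃ w : List (Letter N), w.length = n ∧
      ∃ i a, x = Fword N w (F N i (corner N a)) := by
  rw [mem_V_iff]
  constructor
  · rintro ⟨w, hw, a, rfl⟩
    have hne : w ≠ [] := by rintro rfl; simp at hw
    refine ⟨w.dropLast, by simp [hw], w.getLast hne, a, ?_⟩
    rw [← Fword_concat, List.dropLast_append_getLast]
  · rintro ⟨w, hw, i, a, rfl⟩
    exact ⟨w ++ [i], by simp [hw], a, by rw [Fword_concat]⟩

theorem exists_corner_of_Fword_eq_corner {N : ℕ} [NeZero N] (w : List (Letter N)) {x : K N}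
    {a : Fin 3} (h : Fword N w x = corner N a) : ∃ b, x = corner N b := by
  induction w generalizing a with
  | nil => exact ⟨a, h⟩
  | cons i w ih => exact ih (F_eq_corner_iff.1 h).2

/-- Distinct cells of the same level meet only in boundary points. -/
theorem exists_corner_of_Fword_eq {N : ℕ} [NeZero N] {w w' : List (Letter N)}
    (hl : w.length = w'.length) (hw : w ≠ w') {x y : K N} (h : Fword N w x = Fword N w' y) :
    (∃ a, x = corner N a) ∧ ∃ b, y = corner N b := by
  induction w generalizing w' with
  | nil =>
    cases w' with
    | nil => exact absurd rfl hw
    | cons j w' => simp at hl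
  | cons i w ih =>
    cases w' with
    | nil => simp at hl
    | cons j w' =>
      rcases F_eq_iff.1 h with ⟨rfl, hF⟩ | ⟨-, h1, h2⟩ | ⟨-, h1, h2⟩
      · exact ih (by simpa using hl) (fun e => hw (by rw [e])) hF
      · exact ⟨exists_corner_of_Fword_eq_corner w h1, exists_corner_of_Fword_eq_corner w' h2⟩
      · exact ⟨exists_corner_of_Fword_eq_corner w h1, exists_corner_of_Fword_eq_corner w' h2⟩

/-- Distinct cells of the same level share at most one point. -/
theorem eq_of_Fword_eq_of_Fword_eq {N : ℕ} [NeZero N] {w w' : List (Letter N)}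
    (hl : w.length = w'.length) (hw : w ≠ w') {x y x' y' : K N}
    (h : Fword N w x = Fword N w' y) (h' : Fword N w x' = Fword N w' y') : x = x' := by
  have h12 : corner N 1 ≠ corner N 2 := fun h => absurd (corner_injective N h) (by decide)
  induction w generalizing w' with
  | nil =>
    cases w' with
    | nil => exact absurd rfl hw
    | cons j w' => simp at hl
  | cons i w ih =>
    cases w' with
    | nil => simp at hl
    | cons j w' =>
      rcases F_eq_iff.1 h with ⟨rfl, hF⟩ | ⟨e, h1, h2⟩ | ⟨e, h1, h2⟩
      · rcases F_eq_iff.1 h' with ⟨-, hF'⟩ | ⟨e, -, -⟩ | ⟨e, -, -⟩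
        · exact ih (by simpa using hl) (fun e => hw (by rw [e])) hF hF'
        · exact absurd e (letter_ne_add_one i)
        · exact absurd e (letter_ne_add_one i)
      · rcases F_eq_iff.1 h' with ⟨e', -⟩ | ⟨e', h1', -⟩ | ⟨e', -, -⟩
        · exact absurd (e'.symm.trans e) (letter_ne_add_one j)
        · exact Fword_injective N w (h1.trans h1'.symm)
        · exact absurd (e'.trans (by rw [e])) (letter_ne_add_two j)
      · rcases F_eq_iff.1 h' with ⟨e', -⟩ | ⟨e', -, -⟩ | ⟨e', h1', -⟩
        · exact absurd (e'.trans e) (letter_ne_add_one i)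
        · exact absurd (e'.trans (by rw [e])) (letter_ne_add_two i)
        · exact Fword_injective N w (h1.trans h1'.symm)

/-- A point of a cell of level `n` which belongs to `V_n` is a boundary point of that cell. -/
theorem exists_corner_of_Fword_mem_V {N n : ℕ} [NeZero N] {w : List (Letter N)}
    (hw : w.length = n) {x : K N} (h : Fword N w x ∈ V N n) : ∃ a, x = corner N a := by
  obtain ⟨w', hw', a, h⟩ := mem_V_iff.1 h
  by_cases e : w = w'
  · subst e
    exact ⟨a, Fword_injective N w h⟩
  · exact (exists_corner_of_Fword_eq (hw.trans hw'.symm) e h).1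

/-! ### Cells at a point, and the Laplacian as an average over them -/

/-- The words of length `n`. -/
abbrev Word (N n : ℕ) : Type := {w : List (Letter N) // w.length = n}

noncomputable instance (N n : ℕ) [NeZero N] : Fintype (Word N n) :=
  inferInstanceAs (Fintype (List.Vector (Letter N) n))

open Classical in
/-- The corners of level-`n` cells which sit at the point `p`. -/
noncomputable def corners (N n : ℕ) [NeZero N] (p : K N) :
    Finset (Word N n × Fin 3) :=
  {c | Fword N c.1.1 (corner N c.2) = p}

theorem mem_corners {N n : ℕ} [NeZero N] {p : K N} {c : Word N n × Fin 3} :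
    c ∈ corners N n p ↔ Fword N c.1.1 (corner N c.2) = p := by
  simp [corners]

theorem corners_nonempty {N n : ℕ} [NeZero N] {p : K N} (hp : p ∈ V N n) :
    (corners N n p).Nonempty := by
  obtain ⟨w, hw, a, rfl⟩ := mem_V_iff.1 hp
  exact ⟨(⟨w, hw⟩, a), mem_corners.2 rfl⟩

theorem Fword_corner_mem {N n : ℕ} (w : Word N n) (a : Fin 3) :
    Fword N w.1 (corner N a) ∈ V N n :=
  mem_V_iff.2 ⟨w.1, w.2, a, rfl⟩

theorem graph_adj_iff {N n : ℕ} [NeZero N] {x y : V N n} :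
    (graph N n).Adj x y ↔ ∃ c ∈ corners N n x, ∃ b, b ≠ c.2 ∧ Fword N c.1.1 (corner N b) = y := by
  constructor
  · rintro ⟨hne, w, hw, ⟨_, hu, hx⟩, ⟨_, hv, hy⟩⟩
    obtain ⟨a, rfl⟩ := mem_V_zero.1 hu
    obtain ⟨b, rfl⟩ := mem_V_zero.1 hv
    refine ⟨(⟨w, hw⟩, a), mem_corners.2 hx, b, ?_, hy⟩
    rintro rfl
    exact hne (Subtype.ext (hx.symm.trans hy))
  · rintro ⟨⟨w, a⟩, hc, b, hb, hy⟩
    have hx := mem_corners.1 hc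
    refine ⟨?_, w.1, w.2, ⟨_, mem_V_zero.2 ⟨a, rfl⟩, hx⟩, ⟨_, mem_V_zero.2 ⟨b, rfl⟩, hy⟩⟩
    rintro rfl
    exact hb (corner_injective N (Fword_injective N w.1 (hy.trans hx.symm)))

-- Edges at `p` correspond bijectively to a cell corner at `p` together with another corner of that
-- cell. No neighbour is counted twice because distinct cells share at most one point. With `h = 1`
-- this gives the degree as twice the number of cells.
open Classical in
theorem sum_neighborFinset {N n : ℕ} [NeZero N] (p : V N n) (h : K N → ℂ) :
    ∑ y ∈ (graph N n).neighborFinset p, h y =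
      ∑ c ∈ corners N n p, ∑ b ∈ Finset.univ.erase c.2, h (Fword N c.1.1 (corner N b)) := by
  rw [Finset.sum_sigma']
  symm
  refine Finset.sum_bij
    (fun c _ => (⟨Fword N c.1.1.1 (corner N c.2), Fword_corner_mem _ _⟩ : V N n)) ?_ ?_ ?_ ?_
  · rintro ⟨c, b⟩ hc
    rw [Finset.mem_sigma, Finset.mem_erase] at hc
    rw [SimpleGraph.mem_neighborFinset]
    exact graph_adj_iff.2 ⟨c, hc.1, b, hc.2.1, rfl⟩
  · rintro ⟨⟨w, a⟩, b⟩ hc ⟨⟨w', a'⟩, b'⟩ hc' e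
    simp only [Finset.mem_sigma, mem_corners, Finset.mem_erase] at hc hc'
    have e := congrArg Subtype.val e
    simp only at e
    by_cases hw : w = w'
    · subst hw
      have h1 := corner_injective N (Fword_injective N _ e)
      have h2 := corner_injective N (Fword_injective N _ (hc.1.trans hc'.1.symm))
      subst h1 h2
      rfl
    -- Distinct cells containing both `p` and this neighbour would share two points.
    · exact absurd (corner_injective N (eq_of_Fword_eq_of_Fword_eq (w.2.trans w'.2.symm)
        (fun h => hw (Subtype.ext h)) e (hc.1.trans hc'.1.symm))) hc.2.1
  · intro y hy
    rw [SimpleGraph.mem_neighborFinset] at hy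
    obtain ⟨c, hc, b, hb, e⟩ := graph_adj_iff.1 hy
    exact ⟨⟨c, b⟩, by simp [hc, hb], Subtype.ext e⟩
  · intros; rfl

open Classical in
theorem degree_eq {N n : ℕ} [NeZero N] (p : V N n) :
    ((graph N n).degree p : ℂ) = 2 * ((corners N n p).card : ℂ) := by
  have h := sum_neighborFinset p (fun _ => (1 : ℂ))
  simp only [Finset.sum_const, Finset.card_erase_of_mem (Finset.mem_univ _), Finset.card_univ,
    Fintype.card_fin, nsmul_eq_mul, mul_one, SimpleGraph.card_neighborFinset_eq_degree] at h
  rw [h]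
  push_cast
  ring

/-- The Laplacian averages the local Laplacians of the cells at a point. -/
theorem card_mul_lap_mulVec {N n : ℕ} [NeZero N] (h : K N → ℂ) (p : V N n) :
    ((corners N n p).card : ℂ) * (lap N n).mulVec (fun x => h x) p =
      ∑ c ∈ corners N n p,
        (h p - (∑ b ∈ Finset.univ.erase c.2, h (Fword N c.1.1 (corner N b))) / 2) := by
  classical
  have hc : ((corners N n p).card : ℂ) ≠ 0 :=
    Nat.cast_ne_zero.2 (Finset.card_ne_zero.2 (corners_nonempty p.2))
  rw [lap_mulVec, sum_neighborFinset, degree_eq, Finset.sum_sub_distrib, Finset.sum_const,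
    nsmul_eq_mul, ← Finset.sum_div]
  field_simp

theorem card_corners_ne_zero {N n : ℕ} [NeZero N] (p : V N n) :
    ((corners N n p).card : ℂ) ≠ 0 :=
  Nat.cast_ne_zero.2 (Finset.card_ne_zero.2 (corners_nonempty p.2))

/-! ### Subdivision of cells -/

/-- The subcell `w i` of the cell `w`. -/
def subcell {N n : ℕ} (w : Word N n) (i : Letter N) :
    Word N (n + 1) :=
  ⟨w.1 ++ [i], by simp [w.2]⟩

theorem Fword_subcell {N n : ℕ} (w : Word N n) (i : Letter N) (x : K N) :
    Fword N (subcell w i).1 x = Fword N w.1 (F N i x) :=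
  Fword_concat N w.1 i x

theorem exists_eq_subcell {N n : ℕ} (u : Word N (n + 1)) :
    ∃ w i, u = subcell w i := by
  obtain ⟨u, hu⟩ := u
  have hne : u ≠ [] := by rintro rfl; simp at hu
  exact ⟨⟨u.dropLast, by simp [hu]⟩, u.getLast hne,
    Subtype.ext (List.dropLast_append_getLast hne).symm⟩

theorem subcell_inj {N n : ℕ} {w w' : Word N n} {i i' : Letter N} :
    subcell w i = subcell w' i' ↔ w = w' ∧ i = i' := by
  constructor
  · intro h
    have h := List.append_inj' (congrArg Subtype.val h) rfl
    exact ⟨Subtype.ext h.1, by simpa using h.2⟩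
  · rintro ⟨rfl, rfl⟩; rfl

/-- The corners of level `n + 1` at a point of `V_n` are those of level `n`. -/
theorem sum_corners_succ_of_mem {N n : ℕ} [NeZero N] {p : K N} (hp : p ∈ V N n)
    (f : Word N (n + 1) × Fin 3 → ℂ) :
    ∑ c ∈ corners N (n + 1) p, f c =
      ∑ c ∈ corners N n p, f (subcell c.1 (cornerLetter N c.2), 0) := by
  symm
  refine Finset.sum_bij (fun c _ => (subcell c.1 (cornerLetter N c.2), 0)) ?_ ?_ ?_ ?_
  · rintro c hc
    rw [mem_corners] at hc ⊢
    rw [Fword_subcell, F_corner_zero, hc]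
  · rintro ⟨w, a⟩ _ ⟨w', a'⟩ _ e
    obtain ⟨h1, h2⟩ := subcell_inj.1 (congrArg Prod.fst e)
    exact Prod.ext h1 (cornerLetter_injective N h2)
  · rintro ⟨u, a⟩ hc
    obtain ⟨w, i, rfl⟩ := exists_eq_subcell u
    rw [mem_corners, Fword_subcell] at hc
    -- A subcell corner lying in `V_n` must be a boundary point `v_b` of the large cell, which
    -- occurs only as the first corner of the subcell with letter `cornerLetter N b`.
    obtain ⟨b, hb⟩ := exists_corner_of_Fword_mem_V w.2 (hc.symm ▸ hp)
    obtain ⟨h1, h2⟩ := F_eq_corner_iff.1 hb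
    obtain rfl : a = 0 := corner_injective N h2
    subst h1
    exact ⟨(w, b), mem_corners.2 (by rw [← F_corner_zero]; exact hc), rfl⟩
  · intros; rfl

theorem card_corners_succ {N n : ℕ} [NeZero N] {p : K N} (hp : p ∈ V N n) :
    (corners N (n + 1) p).card = (corners N n p).card := by
  have := sum_corners_succ_of_mem hp (fun _ => 1)
  simpa using this

/-- A point in the interior of a level-`n` cell lies in no other such cell. -/
theorem mem_corners_succ_of_interior {N n : ℕ} [NeZero N] {w : Word N n} {x : K N}
    (hx : ∀ a, x ≠ corner N a) {c : Word N (n + 1) × Fin 3} :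
    c ∈ corners N (n + 1) (Fword N w.1 x) ↔
      ∃ i, c.1 = subcell w i ∧ F N i (corner N c.2) = x := by
  obtain ⟨u, a⟩ := c
  obtain ⟨w', i, rfl⟩ := exists_eq_subcell u
  rw [mem_corners, Fword_subcell]
  constructor
  · intro h
    have hw : w' = w := by
      by_contra hw
      obtain ⟨-, b, hb⟩ := exists_corner_of_Fword_eq (w'.2.trans w.2.symm)
        (fun e => hw (Subtype.ext e)) h
      exact hx b hb
    subst hw
    exact ⟨i, rfl, Fword_injective N _ h⟩
  · rintro ⟨j, h, rfl⟩
    obtain ⟨rfl, rfl⟩ := subcell_inj.1 h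
    rfl

theorem corner_ne (N : ℕ) [NeZero N] {a b : Fin 3} (h : a ≠ b) : corner N a ≠ corner N b :=
  fun e => h (corner_injective N e)

theorem F_corner_zero_ne_corner {N : ℕ} [NeZero N] {i : Letter N}
    (hi : ∀ a, i ≠ cornerLetter N a) (a : Fin 3) : F N i (corner N 0) ≠ corner N a :=
  fun h => hi a (F_eq_corner_iff.1 h).1

theorem F_corner_two_ne_corner {N : ℕ} [NeZero N] (i : Letter N) (a : Fin 3) :
    F N i (corner N 2) ≠ corner N a :=
  fun h => corner_ne N (by decide) (F_eq_corner_iff.1 h).2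

theorem corners_outer {N n : ℕ} [NeZero N] (w : Word N n) {i : Letter N}
    (hi : ∀ a, i ≠ cornerLetter N a) :
    corners N (n + 1) (Fword N w.1 (F N i (corner N 0))) = {(subcell w i, 0)} := by
  ext ⟨u, a⟩
  rw [mem_corners_succ_of_interior (F_corner_zero_ne_corner hi), Finset.mem_singleton,
    Prod.mk.injEq]
  constructor
  · rintro ⟨j, rfl, h⟩
    rcases F_eq_iff.1 h with ⟨rfl, e⟩ | ⟨-, -, h⟩ | ⟨-, -, h⟩
    · exact ⟨rfl, corner_injective N e⟩
    · exact absurd h (corner_ne N (by decide))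
    · exact absurd h (corner_ne N (by decide))
  · rintro ⟨rfl, rfl⟩
    exact ⟨i, rfl, rfl⟩

open Classical in
theorem corners_inner {N n : ℕ} [NeZero N] (w : Word N n) (i : Letter N) :
    corners N (n + 1) (Fword N w.1 (F N i (corner N 2))) =
      {(subcell w i, 2), (subcell w (i + 1), 1)} := by
  ext ⟨u, a⟩
  rw [mem_corners_succ_of_interior (F_corner_two_ne_corner i), Finset.mem_insert,
    Finset.mem_singleton, Prod.mk.injEq, Prod.mk.injEq]
  constructor
  · rintro ⟨j, rfl, h⟩
    rcases F_eq_iff.1 h with ⟨rfl, e⟩ | ⟨rfl, e, -⟩ | ⟨-, -, h⟩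
    · exact Or.inl ⟨rfl, corner_injective N e⟩
    · exact Or.inr ⟨rfl, corner_injective N e⟩
    · exact absurd h (corner_ne N (by decide))
  · rintro (⟨rfl, rfl⟩ | ⟨rfl, rfl⟩)
    · exact ⟨i, rfl, rfl⟩
    · exact ⟨i + 1, rfl, F_corner_one N i⟩

/-! ### Schur complement and reduction to one cell -/

theorem sum_V_succ {N n : ℕ} [NeZero N] (f : V N (n + 1) → ℂ) :
    ∑ x, f x = ∑ p, f (old N n p) + ∑ q, f (new N n q) := by
  classical
  rw [← (Equiv.Set.sumDiffSubset (V_subset_succ N n)).sum_comp, Fintype.sum_sum_type]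
  rfl

open Classical in
/-- The Schur complement acts on boundary data by extending them to a solution on the new
vertices. -/
theorem schur_mulVec {N n : ℕ} [NeZero N] {z : ℂ} (hD : IsUnit (blockD N n z).det)
    (h : V N (n + 1) → ℂ) (hnew : ∀ q, (shifted N n z).mulVec h (new N n q) = 0) (p : V N n) :
    (schur N n z).mulVec (h ∘ old N n) p = (shifted N n z).mulVec h (old N n p) := by
  have split : ∀ x, (shifted N n z).mulVec h x =
      ∑ p, shifted N n z x (old N n p) * h (old N n p) +
        ∑ q, shifted N n z x (new N n q) * h (new N n q) := fun x => sum_V_succ _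
  have h1 : ((shifted N n z).submatrix (new N n) (old N n)).mulVec (h ∘ old N n) =
      -(blockD N n z).mulVec (h ∘ new N n) := by
    funext q
    have := hnew q
    rw [split] at this
    exact eq_neg_of_add_eq_zero_left this
  have h2 : ((shifted N n z).submatrix (old N n) (new N n) * (blockD N n z)⁻¹ *
      (shifted N n z).submatrix (new N n) (old N n)).mulVec (h ∘ old N n) =
      -((shifted N n z).submatrix (old N n) (new N n)).mulVec (h ∘ new N n) := by
    rw [← Matrix.mulVec_mulVec, h1, Matrix.mulVec_neg, Matrix.mulVec_mulVec, Matrix.mul_assoc,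
      Matrix.nonsing_inv_mul _ hD, Matrix.mul_one]
  rw [schur, Matrix.sub_mulVec]
  erw [h2]
  rw [sub_neg_eq_add, split]
  rfl

theorem shifted_mulVec {N n : ℕ} [NeZero N] (z : ℂ) (h : V N (n + 1) → ℂ) (x : V N (n + 1)) :
    (shifted N n z).mulVec h x = (lap N (n + 1)).mulVec h x - z * h x := by
  simp [shifted, Matrix.sub_mulVec, Matrix.smul_mulVec]

/-- The boundary value problem on one cell: boundary data `g` extend to values `Y i` at the outer
points `F_i(v_1)` and `X i` at the inner points `F_i(v_3) = F_{i+1}(v_2)` solving the eigenvalue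
equation in the interior, with the normal derivatives of a Laplacian on the boundary. -/
def HasLocalExtension (N : ℕ) (z r φ : ℂ) : Prop :=
  ∀ g : Fin 3 → ℂ, ∃ X Y : Letter N → ℂ,
    (∀ a, Y (cornerLetter N a) = g a) ∧
    (∀ i, (∀ a, i ≠ cornerLetter N a) → (1 - z) * Y i = (X (i - 1) + X i) / 2) ∧
    (∀ i, 4 * (1 - z) * X i = X (i - 1) + X (i + 1) + Y i + Y (i + 1)) ∧
    ∀ a, (1 - z) * g a - (X (cornerLetter N a - 1) + X (cornerLetter N a)) / 2 =
      φ * ((1 - r) * g a - (∑ b ∈ Finset.univ.erase a, g b) / 2)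

open Classical in
/-- The function on `V_1` with the values `Y i` at `F_i(v_1)` and `X i` at `F_i(v_3)`. -/
noncomputable def localFun (N : ℕ) (X Y : Letter N → ℂ) (x : K N) : ℂ :=
  if h : ∃ i, F N i (corner N 0) = x then Y h.choose
  else if h : ∃ i, F N i (corner N 2) = x then X h.choose else 0

theorem localFun_zero {N : ℕ} [NeZero N] (X Y : Letter N → ℂ) (i : Letter N) :
    localFun N X Y (F N i (corner N 0)) = Y i := by
  have h : ∃ j, F N j (corner N 0) = F N i (corner N 0) := ⟨i, rfl⟩
  rw [localFun, dif_pos h]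
  rcases F_eq_iff.1 h.choose_spec with ⟨e, -⟩ | ⟨-, e, -⟩ | ⟨-, e, -⟩
  · rw [e]
  · exact absurd e (corner_ne N (by decide))
  · exact absurd e (corner_ne N (by decide))

theorem localFun_two {N : ℕ} [NeZero N] (X Y : Letter N → ℂ) (i : Letter N) :
    localFun N X Y (F N i (corner N 2)) = X i := by
  have h : ∃ j, F N j (corner N 2) = F N i (corner N 2) := ⟨i, rfl⟩
  have h0 : ¬ ∃ j, F N j (corner N 0) = F N i (corner N 2) := by
    rintro ⟨j, hj⟩
    rcases F_eq_iff.1 hj with ⟨-, e⟩ | ⟨-, e, -⟩ | ⟨-, e, -⟩ <;>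
      exact absurd e (corner_ne N (by decide))
  rw [localFun, dif_neg h0, dif_pos h]
  rcases F_eq_iff.1 h.choose_spec with ⟨e, -⟩ | ⟨-, e, -⟩ | ⟨-, -, e⟩
  · rw [e]
  · exact absurd e (corner_ne N (by decide))
  · exact absurd e (corner_ne N (by decide))

theorem localFun_one {N : ℕ} [NeZero N] (X Y : Letter N → ℂ) (i : Letter N) :
    localFun N X Y (F N i (corner N 1)) = X (i - 1) := by
  conv_lhs => rw [← sub_add_cancel i 1]
  rw [F_corner_one, localFun_two]

/-- Extensions on the single cells fit together. -/
theorem exists_global_extension {N n : ℕ} [NeZero N] (f : V N n → ℂ)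
    (X Y : Word N n → Letter N → ℂ)
    (hY : ∀ w a, Y w (cornerLetter N a) = f ⟨_, Fword_corner_mem w a⟩) :
    ∃ h : K N → ℂ, (∀ p : V N n, h p = f p) ∧
      ∀ w x, x ∈ V N 1 → h (Fword N w.1 x) = localFun N (X w) (Y w) x := by
  classical
  -- Outside `V_n` a point lies in at most one cell, so the choice below is forced; the default `0`
  -- plays no role.
  refine ⟨fun p => if hp : p ∈ V N n then f ⟨p, hp⟩ else
    if hp : ∃ c : Word N n × K N, Fword N c.1.1 c.2 = p then
      localFun N (X hp.choose.1) (Y hp.choose.1) hp.choose.2 else 0, ?_, ?_⟩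
  · intro p
    simp
  · intro w x hx
    by_cases hp : Fword N w.1 x ∈ V N n
    · obtain ⟨a, rfl⟩ := exists_corner_of_Fword_mem_V w.2 hp
      have : localFun N (X w) (Y w) (corner N a) = f ⟨_, Fword_corner_mem w a⟩ := by
        rw [← hY w a, ← localFun_zero (X w) (Y w), F_corner_zero]
      rw [this]
      exact dif_pos hp
    · have hc : ∃ c : Word N n × K N, Fword N c.1.1 c.2 = Fword N w.1 x :=
        ⟨(w, x), rfl⟩
      have h1 := hc.choose_spec
      have hw : hc.choose.1 = w := by
        by_contra hw
        obtain ⟨-, a, rfl⟩ := exists_corner_of_Fword_eq (hc.choose.1.2.trans w.2.symm)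
          (fun e => hw (Subtype.ext e)) h1
        exact hp (Fword_corner_mem w a)
      have hx' : hc.choose.2 = x := by
        rw [hw] at h1
        exact Fword_injective N _ h1
      refine (dif_neg hp).trans ((dif_pos hc).trans ?_)
      rw [hw, hx']

theorem F_corner_mem_V_one {N : ℕ} (i : Letter N) (a : Fin 3) : F N i (corner N a) ∈ V N 1 :=
  Set.mem_iUnion.2 ⟨i, _, mem_V_zero.2 ⟨a, rfl⟩, rfl⟩

-- The cellwise solutions agree on shared corners and glue to a function `h` satisfying the
-- eigenvalue equation at every new vertex, so the Schur complement of `f` is `(Δ_{n+1} - z) h` on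
-- `V_n`. There the sum of the normal derivatives over the cells at `p` reproduces `Δ_n f`.
open Classical in
theorem schur_eq_of_hasLocalExtension {N n : ℕ} [NeZero N] {z r φ : ℂ}
    (hloc : HasLocalExtension N z r φ) (hD : IsUnit (blockD N n z).det) (f : V N n → ℂ)
    (p : V N n) :
    (schur N n z).mulVec f p = φ * ((lap N n).mulVec f p - r * f p) := by
  choose X Y hY1 hY hX hN using
    fun w : Word N n => hloc (fun a => f ⟨_, Fword_corner_mem w a⟩)
  obtain ⟨h, hf, hh⟩ := exists_global_extension f X Y hY1
  have h0 : ∀ w i, h (Fword N w.1 (F N i (corner N 0))) = Y w i := fun w i => by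
    rw [hh _ _ (F_corner_mem_V_one _ _), localFun_zero]
  have h1 : ∀ w i, h (Fword N w.1 (F N i (corner N 1))) = X w (i - 1) :=
    fun w i => by rw [hh _ _ (F_corner_mem_V_one _ _), localFun_one]
  have h2 : ∀ w i, h (Fword N w.1 (F N i (corner N 2))) = X w i := fun w i => by
    rw [hh _ _ (F_corner_mem_V_one _ _), localFun_two]
  have hsub : ∀ (w : Word N n) i a,
      h (Fword N (subcell w i).1 (corner N a)) = h (Fword N w.1 (F N i (corner N a))) :=
    fun w i a => by rw [Fword_subcell]
  have e0 : Finset.univ.erase (0 : Fin 3) = {1, 2} := by decide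
  have e1 : Finset.univ.erase (1 : Fin 3) = {0, 2} := by decide
  have e2 : Finset.univ.erase (2 : Fin 3) = {0, 1} := by decide
  have s12 : ∀ F : Fin 3 → ℂ, ∑ b ∈ ({1, 2} : Finset (Fin 3)), F b = F 1 + F 2 := fun F =>
    Finset.sum_pair (by decide)
  have s02 : ∀ F : Fin 3 → ℂ, ∑ b ∈ ({0, 2} : Finset (Fin 3)), F b = F 0 + F 2 := fun F =>
    Finset.sum_pair (by decide)
  have s01 : ∀ F : Fin 3 → ℂ, ∑ b ∈ ({0, 1} : Finset (Fin 3)), F b = F 0 + F 1 := fun F =>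
    Finset.sum_pair (by decide)
  have hnew : ∀ q, (shifted N n z).mulVec (fun x => h x) (new N n q) = 0 := by
    rintro ⟨q, hq, hqn⟩
    have key := card_mul_lap_mulVec h (n := n + 1) ⟨q, hq⟩
    have hc := card_corners_ne_zero (n := n + 1) ⟨q, hq⟩
    rw [shifted_mulVec]
    change (lap N (n + 1)).mulVec (fun x => h x) ⟨q, hq⟩ - z * h q = 0
    obtain ⟨w, hw, i, a, hqw⟩ := mem_V_succ_iff.1 hq
    have outer : q = Fword N w (F N i (corner N 0)) →
        (lap N (n + 1)).mulVec (fun x => h x) ⟨q, hq⟩ - z * h q = 0 := by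
      intro hqw
      subst hqw
      have hi : ∀ a, i ≠ cornerLetter N a := by
        rintro a rfl
        rw [F_corner_zero] at hqn
        exact hqn (Fword_corner_mem ⟨w, hw⟩ a)
      have hco := corners_outer ⟨w, hw⟩ hi
      simp only at hco key hc
      rw [hco] at key hc
      rw [Finset.sum_singleton] at key
      simp only at key
      rw [e0, s12, hsub, hsub, Finset.card_singleton, Nat.cast_one, one_mul,
        h1, h2] at key
      have e := h0 ⟨w, hw⟩ i
      rw [key, e]
      linear_combination hY ⟨w, hw⟩ i hi
    have inner : ∀ i, q = Fword N w (F N i (corner N 2)) →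
        (lap N (n + 1)).mulVec (fun x => h x) ⟨q, hq⟩ - z * h q = 0 := by
      intro i hqw
      subst hqw
      have hco := corners_inner ⟨w, hw⟩ i
      simp only at hco key hc
      have hne : ((subcell ⟨w, hw⟩ i, 2) : Word N (n + 1) × Fin 3) ≠
          (subcell ⟨w, hw⟩ (i + 1), 1) := fun e =>
          absurd (show (2 : Fin 3) = 1 from congrArg Prod.snd e) (by decide)
      rw [hco] at key hc
      rw [Finset.sum_pair hne] at key
      simp only at key
      rw [e1, e2, s02, s01, hsub, hsub, hsub, hsub, Finset.card_pair hne,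
        h0, h0, h1, h2] at key
      have e := h2 ⟨w, hw⟩ i
      rw [e] at key ⊢
      push_cast at key
      linear_combination key / 2 + hX ⟨w, hw⟩ i / 4
    fin_cases a
    · exact outer hqw
    · refine inner (i - 1) ?_
      rw [← F_corner_one, sub_add_cancel]
      exact hqw
    · exact inner i hqw
  have hfo : (fun x : V N (n + 1) => h x) ∘ old N n = f := funext hf
  have hff : (fun x : V N n => h x) = f := funext hf
  rw [← hfo, schur_mulVec hD _ hnew, shifted_mulVec, hfo]
  have k1 := card_mul_lap_mulVec h (old N n p)
  have k2 := card_mul_lap_mulVec h p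
  have hc := card_corners_ne_zero p
  change ((corners N (n + 1) (p : K N)).card : ℂ) * _ = ∑ c ∈ corners N (n + 1) (p : K N), _ at k1
  rw [hff] at k2
  rw [card_corners_succ p.2, sum_corners_succ_of_mem p.2] at k1
  change _ = ∑ c ∈ corners N n (p : K N), (h p - _) at k1
  change _ - z * h p = _
  simp only at k1
  -- Each summand is the normal derivative condition `hN` of one cell at `p`; the last term collects
  -- the multiples of `f p`.
  have hs : ∑ c ∈ corners N n (p : K N), (h p - (∑ b ∈ Finset.univ.erase (0 : Fin 3),
        h (Fword N (subcell c.1 (cornerLetter N c.2)).1 (corner N b))) / 2) =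
      φ * ∑ c ∈ corners N n (p : K N), (h p - (∑ b ∈ Finset.univ.erase c.2,
        h (Fword N c.1.1 (corner N b))) / 2) +
      ((corners N n (p : K N)).card : ℂ) * (z * h p - φ * (r * f p)) := by
    rw [Finset.mul_sum, ← nsmul_eq_mul, ← Finset.sum_const, ← Finset.sum_add_distrib]
    refine Finset.sum_congr rfl fun c hcm => ?_
    rw [mem_corners] at hcm
    have hb : ∀ b, f ⟨_, Fword_corner_mem c.1 b⟩ = h (Fword N c.1.1 (corner N b)) :=
      fun b => (hf ⟨_, Fword_corner_mem c.1 b⟩).symm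
    have := hN c.1 c.2
    have hfp : ∀ hp, f ⟨(p : K N), hp⟩ = h p := fun _ => (hf p).symm
    simp only [hb, hcm, hfp] at this
    rw [e0, s12, hsub, hsub, h1, h2, ← hf p]
    linear_combination this
  apply mul_left_cancel₀ hc
  linear_combination k1 - φ * k2 + hs

open Classical in
theorem schur_eq {N n : ℕ} [NeZero N] {z r φ : ℂ}
    (hloc : HasLocalExtension N z r φ) (hD : IsUnit (blockD N n z).det) :
    schur N n z = φ • (lap N n - r • 1) := by
  refine Matrix.toLin'.injective (LinearMap.ext fun f => funext fun p => ?_)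
  rw [Matrix.toLin'_apply, Matrix.toLin'_apply, schur_eq_of_hasLocalExtension hloc hD]
  simp [Matrix.smul_mulVec, Matrix.sub_mulVec]

/-! ### Green function of the cycle and solution of the boundary value problem -/

open Polynomial.Chebyshev in
-- With `c = cos θ` these are double and triple angle formulas for `Nθ`; excluding `c = ±1` makes
-- `sin θ` cancellable.
theorem cheb_multiple_angle {N : ℕ} {c t u : ℂ} (h1 : c ≠ 1) (h2 : c ≠ -1)
    (ht : (T ℂ N).eval c = t) (hu : (U ℂ (N - 1)).eval c = u) :
    t ^ 2 - (c ^ 2 - 1) * u ^ 2 = 1 ∧ (U ℂ (2 * N - 1)).eval c = 2 * t * u ∧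
      (U ℂ (3 * N - 1)).eval c = u * (4 * t ^ 2 - 1) ∧
      (T ℂ (2 * N)).eval c = 2 * t ^ 2 - 1 ∧ (T ℂ (3 * N)).eval c = 4 * t ^ 3 - 3 * t := by
  obtain ⟨θ, rfl⟩ := Complex.cos_surjective c
  have hs : Complex.sin θ ≠ 0 := by
    intro hs
    have := Complex.sin_sq_add_cos_sq θ
    rw [hs] at this
    rcases sq_eq_sq_iff_eq_or_eq_neg.1
        (by linear_combination this : Complex.cos θ ^ 2 = 1 ^ 2) with h | h
    · exact h1 h
    · exact h2 h
  have hsc := Complex.sin_sq_add_cos_sq θ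
  have hu' : u * Complex.sin θ = Complex.sin (N * θ) := by
    rw [← hu, U_complex_cos]; push_cast; ring_nf
  have ht' : t = Complex.cos (N * θ) := by
    rw [← ht, T_complex_cos]; push_cast; ring_nf
  have hp := Complex.sin_sq_add_cos_sq (N * θ)
  rw [← hu', ← ht'] at hp
  refine ⟨by linear_combination hp + u ^ 2 * (-hsc), ?_, ?_, ?_, ?_⟩
  · apply mul_right_cancel₀ hs
    rw [U_complex_cos]
    push_cast
    rw [show (2 * (N : ℂ) - 1 + 1) * θ = 2 * (N * θ) by ring, Complex.sin_two_mul, ← hu', ← ht']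
    ring
  · apply mul_right_cancel₀ hs
    rw [U_complex_cos]
    push_cast
    rw [show (3 * (N : ℂ) - 1 + 1) * θ = 3 * (N * θ) by ring, Complex.sin_three_mul, ← hu']
    linear_combination (-4) * u * Complex.sin θ * hp
  · rw [T_complex_cos]
    push_cast
    rw [show (2 * (N : ℂ)) * θ = 2 * (N * θ) by ring, Complex.cos_two_mul, ← ht']
  · rw [T_complex_cos]
    push_cast
    rw [show (3 * (N : ℂ)) * θ = 3 * (N * θ) by ring, Complex.cos_three_mul, ← ht']

/-- A solution of the three-term recurrence on `ℤ`, symmetric under `j ↦ 3N - 1 - j`. -/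
noncomputable def symSol (N : ℕ) (c : ℂ) (j : ℤ) : ℂ :=
  (Polynomial.Chebyshev.U ℂ (j - 1)).eval c + (Polynomial.Chebyshev.U ℂ (3 * N - 2 - j)).eval c

theorem symSol_rec (N : ℕ) (c : ℂ) (j : ℤ) :
    2 * c * symSol N c j - symSol N c (j - 1) - symSol N c (j + 1) = 0 := by
  have h1 := congrArg (Polynomial.eval c) (Polynomial.Chebyshev.U_eq ℂ j)
  have h2 := congrArg (Polynomial.eval c) (Polynomial.Chebyshev.U_eq ℂ (3 * N - 1 - j))
  simp only [Polynomial.eval_sub, Polynomial.eval_mul, Polynomial.eval_X,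
    Polynomial.eval_ofNat] at h1 h2
  rw [show (3 * N - 1 - j - 1 : ℤ) = 3 * N - 2 - j by ring,
    show (3 * N - 1 - j - 2 : ℤ) = 3 * N - 2 - (j + 1) by ring] at h2
  unfold symSol
  rw [show j - 1 - 1 = j - 2 by ring, show j + 1 - 1 = j by ring,
    show (3 * N - 2 - (j - 1) : ℤ) = 3 * N - 1 - j by ring]
  linear_combination -h1 - h2

theorem symSol_symm (N : ℕ) (c : ℂ) (j : ℤ) : symSol N c (3 * N - 1 - j) = symSol N c j := by
  unfold symSol
  rw [add_comm]
  congr 3 <;> ring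

/-- The jump of `symSol` across the seam of the cycle `ℤ / 3N`. -/
noncomputable def jump (N : ℕ) (c : ℂ) : ℂ := symSol N c (-1) - symSol N c 0

/-- The Green function of the cycle `ℤ / 3N` for the source at `-1` and `0`. -/
noncomputable def green (N : ℕ) (c : ℂ) (i : Letter N) : ℂ := symSol N c i.val / jump N c

theorem green_natCast {N : ℕ} (c : ℂ) {j : ℕ} (hj : j < 3 * N) :
    green N c (j : Letter N) = symSol N c j / jump N c := by
  rw [green, ZMod.val_natCast_of_lt hj]

theorem exists_natCast_eq {N : ℕ} [NeZero N] (i : Letter N) :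
    ∃ j : ℕ, j < 3 * N ∧ (j : Letter N) = i :=
  ⟨i.val, ZMod.val_lt i, ZMod.natCast_zmod_val i⟩

theorem natCast_letter_inj {N : ℕ} {i j : ℕ} (hi : i < 3 * N) (hj : j < 3 * N) :
    (i : Letter N) = (j : Letter N) ↔ i = j := by
  rw [ZMod.natCast_eq_natCast_iff', Nat.mod_eq_of_lt hi, Nat.mod_eq_of_lt hj]

theorem neg_one_letter (N : ℕ) [NeZero N] : (-1 : Letter N) = ((3 * N - 1 : ℕ) : Letter N) := by
  have := NeZero.pos N
  rw [Nat.cast_sub (by omega), ZMod.natCast_self]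
  simp

/-- On the integers `symSol` satisfies the homogeneous recurrence. Closing up the cycle replaces the
neighbour value `symSol (-1)` of `0` by `symSol (3N - 1) = symSol 0`, an error of exactly `jump`; by
symmetry the same happens at `3N - 1`. -/
theorem green_laplace {N : ℕ} [NeZero N] {c : ℂ} (hE : jump N c ≠ 0) (i : Letter N) :
    2 * c * green N c i - green N c (i - 1) - green N c (i + 1) =
      (if i = 0 then 1 else 0) + (if i = -1 then 1 else 0) := by
  have hN := NeZero.pos N
  have hs : symSol N c (3 * N - 1) = symSol N c 0 := by
    rw [← symSol_symm]; congr 1; ring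
  have hs' : symSol N c (3 * N) = symSol N c (-1) := by
    rw [← symSol_symm]; congr 1; ring
  obtain ⟨j, hj, rfl⟩ := exists_natCast_eq i
  have h0 : (j : Letter N) = 0 ↔ j = 0 := by
    rw [← Nat.cast_zero, natCast_letter_inj hj (by omega)]
  have h1 : (j : Letter N) = -1 ↔ j = 3 * N - 1 := by
    rw [neg_one_letter, natCast_letter_inj hj (by omega)]
  have hrec := symSol_rec N c j
  have g0 : green N c 0 = symSol N c 0 / jump N c := by
    simpa using green_natCast c (show 0 < 3 * N by omega)
  have g1 : green N c 1 = symSol N c 1 / jump N c := by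
    simpa using green_natCast c (show 1 < 3 * N by omega)
  simp only [h0, h1]
  rcases Nat.eq_zero_or_pos j with rfl | hjp
  · rw [if_pos rfl, if_neg (by omega), Nat.cast_zero, zero_sub, zero_add, neg_one_letter,
      green_natCast _ (by omega), g0, g1, Nat.cast_sub (by omega)]
    push_cast at hrec ⊢
    rw [hs, add_zero]
    field_simp
    rw [jump]
    linear_combination hrec
  · have em : (j : Letter N) - 1 = ((j - 1 : ℕ) : Letter N) := by
      rw [Nat.cast_sub hjp, Nat.cast_one]
    rw [if_neg (by omega), zero_add, em, green_natCast _ hj, green_natCast _ (by omega),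
      Nat.cast_sub hjp]
    by_cases hl : j = 3 * N - 1
    · have ep : (j : Letter N) + 1 = ((0 : ℕ) : Letter N) := by
        rw [h1.2 hl]; simp
      rw [if_pos hl, ep, green_natCast _ (by omega)]
      rw [show ((j : ℤ) + 1) = 3 * N by omega, hs'] at hrec
      push_cast
      field_simp
      rw [jump]
      linear_combination hrec
    · have ep : (j : Letter N) + 1 = ((j + 1 : ℕ) : Letter N) := by push_cast; rfl
      rw [if_neg hl, ep, green_natCast _ (by omega)]
      push_cast
      field_simp
      linear_combination hrec

/-- Corner letters differ by `0`, `N` or `2N`, and the reflection `j ↦ 3N - 1 - j` exchanges the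
last two cases. So the influence of corner `b` on corner `a` depends only on whether `a = b`. -/
theorem green_pair {N : ℕ} [NeZero N] (c : ℂ) (a b : Fin 3) :
    green N c (cornerLetter N a - cornerLetter N b - 1) +
        green N c (cornerLetter N a - cornerLetter N b) =
      if a = b then 2 * symSol N c 0 / jump N c
      else (symSol N c (N - 1) + symSol N c N) / jump N c := by
  have hN := NeZero.pos N
  have hs : symSol N c (3 * N - 1) = symSol N c 0 := by
    rw [← symSol_symm]; congr 1; ring
  have h0 : green N c (0 - 1) + green N c 0 = 2 * symSol N c 0 / jump N c := by
    rw [zero_sub, neg_one_letter, ← Nat.cast_zero, green_natCast _ (by omega),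
      green_natCast _ (by omega), Nat.cast_sub (by omega)]
    push_cast
    rw [hs]
    ring
  have key : ∀ j : ℕ, 0 < j → j < 3 * N → green N c ((j : Letter N) - 1) + green N c (j : Letter N)
      = (symSol N c (j - 1) + symSol N c j) / jump N c := by
    intro j h1 h2
    rw [green_natCast _ h2, show (j : Letter N) - 1 = ((j - 1 : ℕ) : Letter N) by
      rw [Nat.cast_sub h1, Nat.cast_one], green_natCast _ (by omega), Nat.cast_sub h1, add_div]
    simp
  have hn := key N hN (by omega)
  have h2n : green N c (((2 * N : ℕ) : Letter N) - 1) + green N c ((2 * N : ℕ) : Letter N) =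
      (symSol N c (N - 1) + symSol N c N) / jump N c := by
    rw [key _ (by omega) (by omega), ← symSol_symm N c (N - 1), ← symSol_symm N c N, add_comm]
    congr 3 <;> push_cast <;> ring
  have h3 : (3 : Letter N) * N = 0 := by
    have := ZMod.natCast_self (3 * N)
    push_cast at this
    exact this
  have c0 : cornerLetter N 0 = N := cornerLetter_zero N
  have c1 : cornerLetter N 1 = 2 * N := by rw [cornerLetter_one]; push_cast; rfl
  have c2 : cornerLetter N 2 = 0 := by rw [cornerLetter_two]; push_cast; exact h3
  push_cast at h2n
  have e01 : cornerLetter N 0 - cornerLetter N 1 = 2 * N := by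
    rw [c0, c1]; linear_combination -h3
  have e02 : cornerLetter N 0 - cornerLetter N 2 = N := by rw [c0, c2, sub_zero]
  have e10 : cornerLetter N 1 - cornerLetter N 0 = N := by rw [c0, c1]; ring
  have e12 : cornerLetter N 1 - cornerLetter N 2 = 2 * N := by rw [c1, c2, sub_zero]
  have e20 : cornerLetter N 2 - cornerLetter N 0 = 2 * N := by
    rw [c0, c2]; linear_combination -h3
  have e21 : cornerLetter N 2 - cornerLetter N 1 = N := by
    rw [c1, c2]; linear_combination -h3
  by_cases hab : a = b
  · subst hab
    rw [if_pos rfl, sub_self, h0]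
  · rw [if_neg hab]
    fin_cases a <;> fin_cases b <;> first | exact absurd rfl hab | skip
    · exact e01 ▸ h2n
    · exact e02 ▸ hn
    · exact e10 ▸ hn
    · exact e12 ▸ h2n
    · exact e20 ▸ h2n
    · exact e21 ▸ hn

/-- Set `Y i = (X (i - 1) + X i) / (1 + c)`, plus an unknown defect `δ a` at the corner letter of
`a`. The equations at inner vertices become the cycle equation `hL` with sources `δ`, solved by
superposing Green functions, and `δ` is adjusted to the boundary data `g`. The normal derivative at
corner `a` is then just `(1 - z) * δ a`. -/
theorem hasLocalExtension_of_ne {N : ℕ} [NeZero N] {z t u : ℂ}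
    (ht : (Polynomial.Chebyshev.T ℂ N).eval (1 - 2 * z) = t)
    (hu : (Polynomial.Chebyshev.U ℂ (N - 1)).eval (1 - 2 * z) = u)
    (hz0 : z ≠ 0) (hz1 : z ≠ 1) (hz3 : 3 - 2 * z ≠ 0) (hu0 : u ≠ 0)
    (hG : 2 * t + 2 * u + 1 ≠ 0) (hut : u + t - 1 ≠ 0) (hE : jump N (1 - 2 * z) ≠ 0) :
    HasLocalExtension N z ((1 - t) * (2 * t + 2 * u + 1) / (2 * u))
      ((3 - 2 * z) * u / ((u + t - 1) * (2 * t + 2 * u + 1))) := by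
  have hz1' : 1 - z ≠ 0 := sub_ne_zero.2 hz1.symm
  obtain ⟨c, hc⟩ : ∃ c, c = 1 - 2 * z := ⟨_, rfl⟩
  rw [← hc] at ht hu hE
  have hzc : z = (1 - c) / 2 := by rw [hc]; ring
  obtain ⟨hp, u2, u3, t2, t3⟩ := cheb_multiple_angle
    (fun h => hz0 (by rw [hzc, h]; ring)) (fun h => hz1 (by rw [hzc, h]; ring)) ht hu
  have hU : ∀ n : ℤ, (Polynomial.Chebyshev.U ℂ (n - 2)).eval c =
      c * (Polynomial.Chebyshev.U ℂ (n - 1)).eval c - (Polynomial.Chebyshev.T ℂ n).eval c := by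
    intro n
    have h1 := congrArg (Polynomial.eval c) (Polynomial.Chebyshev.T_eq_U_sub_X_mul_U ℂ n)
    have h2 := congrArg (Polynomial.eval c) (Polynomial.Chebyshev.U_eq ℂ n)
    simp only [Polynomial.eval_sub, Polynomial.eval_mul, Polynomial.eval_X,
      Polynomial.eval_ofNat] at h1 h2
    linear_combination h1 + h2
  have hP0 : symSol N c 0 = c * (u * (4 * t ^ 2 - 1)) - (4 * t ^ 3 - 3 * t) := by
    rw [symSol, sub_zero, hU, u3, t3, zero_sub, Polynomial.Chebyshev.U_neg_one]
    simp
  have hPm : symSol N c (-1) = u * (4 * t ^ 2 - 1) - 1 := by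
    rw [symSol, show (3 * N - 2 - -1 : ℤ) = 3 * N - 1 by ring, u3, show (-1 - 1 : ℤ) = -2 by ring,
      Polynomial.Chebyshev.U_neg_two]
    simp
    ring
  have hPs : symSol N c (N - 1) + symSol N c N =
      u + (c * (2 * t * u) - (2 * t ^ 2 - 1)) + (c * u - t) + 2 * t * u := by
    rw [symSol, symSol, show (3 * N - 2 - (N - 1) : ℤ) = 2 * N - 1 by ring,
      show (3 * N - 2 - N : ℤ) = 2 * N - 2 by ring, show (N - 1 - 1 : ℤ) = N - 2 by ring, hU, hU,
      u2, t2, ht, hu]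
    ring
  have hJ : jump N c = u * (4 * t ^ 2 - 1) - 1 - symSol N c 0 := by rw [jump, hPm]
  obtain ⟨E, hEd⟩ : ∃ E, E = jump N c := ⟨_, rfl⟩
  obtain ⟨A, hA⟩ : ∃ A, A = symSol N c 0 := ⟨_, rfl⟩
  obtain ⟨B, hB⟩ : ∃ B, B = symSol N c (N - 1) + symSol N c N := ⟨_, rfl⟩
  -- In terms of `c, t, u` both identities are multiples of the Pell relation `hp`. They are what
  -- `f1` and `f2` become after clearing denominators.
  have id1 : (2 * t + 1) * (E + 2 * A - B) = 2 * u * (1 + c) * E := by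
    rw [hEd, hA, hB, hJ, hPs, hP0]
    linear_combination (-8 * t ^ 2 + 2) * hp
  have id2 : u * ((c + 2) * E + 2 * A + 2 * B) = (2 * t + 1) * (u + t - 1) * B := by
    rw [hEd, hA, hB, hJ, hPs, hP0]
    linear_combination (4 * t ^ 2 - 1) * hp
  have h3z : 3 - 2 * z = c + 2 := by rw [hc]; ring
  have h1z : 1 - z = (1 + c) / 2 := by rw [hc]; ring
  have hc2 : c + 2 ≠ 0 := h3z ▸ hz3
  have hc1 : 1 + c ≠ 0 := by
    intro h
    rw [h, zero_div] at h1z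
    exact hz1' h1z
  rw [← hEd] at hE
  intro g
  obtain ⟨S, hS⟩ : ∃ S, S = ∑ b, g b := ⟨_, rfl⟩
  -- `α I + β J`, with `J` the all-ones matrix, inverts the map from `δ` to `g`; `f1` and `f2` are
  -- the two coefficient equations.
  obtain ⟨α, hα⟩ : ∃ α, α = (c + 2) * (2 * t + 1) / ((1 + c) * (2 * t + 2 * u + 1)) := ⟨_, rfl⟩
  obtain ⟨β, hβ⟩ : ∃ β, β = -(c + 2) * u / ((1 + c) * ((u + t - 1) * (2 * t + 2 * u + 1))) :=
    ⟨_, rfl⟩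
  have f1 : α * (1 + (2 * A - B) / (E * (c + 2))) = 1 := by
    rw [hα]
    obtain ⟨G, hGd⟩ : ∃ G, G = 2 * t + 2 * u + 1 := ⟨_, rfl⟩
    rw [← hGd] at hG ⊢
    field_simp
    linear_combination id1 - (1 + c) * E * hGd
  have f2 : β * (1 + (2 * A + 2 * B) / (E * (c + 2))) + α * B / (E * (c + 2)) = 0 := by
    rw [hα, hβ]
    obtain ⟨G, hGd⟩ : ∃ G, G = 2 * t + 2 * u + 1 := ⟨_, rfl⟩
    rw [← hGd] at hG ⊢
    field_simp
    linear_combination -id2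
  obtain ⟨δ, hδ⟩ : ∃ δ : Fin 3 → ℂ, ∀ a, δ a = α * g a + β * S := ⟨_, fun _ => rfl⟩
  obtain ⟨X, hXd⟩ : ∃ X : Letter N → ℂ, ∀ i,
      X i = (1 + c) / (c + 2) * ∑ b, δ b * green N c (i - cornerLetter N b) := ⟨_, fun _ => rfl⟩
  have hX : ∀ a, (X (cornerLetter N a - 1) + X (cornerLetter N a)) / (1 + c) + δ a = g a := by
    intro a
    have h1 : X (cornerLetter N a - 1) + X (cornerLetter N a) =
        (1 + c) / (c + 2) * (δ a * ((2 * A - B) / E) + (∑ b, δ b) * (B / E)) := by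
      rw [hXd, hXd, ← mul_add, ← Finset.sum_add_distrib]
      congr 1
      have h2 : ∀ b, δ b * green N c (cornerLetter N a - 1 - cornerLetter N b) +
          δ b * green N c (cornerLetter N a - cornerLetter N b) =
          (if a = b then δ b * ((2 * A - B) / E) else 0) + δ b * (B / E) := by
        intro b
        rw [sub_right_comm, ← mul_add, green_pair, ← hEd, ← hA, ← hB]
        split_ifs <;> ring
      rw [Finset.sum_congr rfl fun b _ => h2 b, Finset.sum_add_distrib, ← Finset.sum_mul]
      simp
    have h2 : ∑ b, δ b = (α + 3 * β) * S := by
      rw [hS, Fin.sum_univ_three, Fin.sum_univ_three]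
      simp only [hδ, hS, Fin.sum_univ_three]
      ring
    rw [h1, h2]
    have h3 : (1 + c) / (c + 2) * (δ a * ((2 * A - B) / E) + (α + 3 * β) * S * (B / E)) / (1 + c) =
        δ a * ((2 * A - B) / (E * (c + 2))) + (α + 3 * β) * S * (B / (E * (c + 2))) := by
      field_simp
    rw [h3]
    rw [hδ]
    linear_combination g a * f1 + S * f2
  have hL : ∀ i, 2 * c * X i - X (i - 1) - X (i + 1) = (1 + c) / (c + 2) *
      ((∑ b, if i = cornerLetter N b then δ b else 0) +
        ∑ b, if i + 1 = cornerLetter N b then δ b else 0) := by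
    intro i
    have h1 : ∀ b, 2 * c * (δ b * green N c (i - cornerLetter N b)) -
        δ b * green N c (i - 1 - cornerLetter N b) - δ b * green N c (i + 1 - cornerLetter N b) =
        (if i = cornerLetter N b then δ b else 0) +
          if i + 1 = cornerLetter N b then δ b else 0 := by
      intro b
      have h := green_laplace (hEd ▸ hE) (i - cornerLetter N b)
      have e : i - cornerLetter N b = -1 ↔ i + 1 = cornerLetter N b := by
        rw [sub_eq_iff_eq_add, neg_add_eq_sub, eq_sub_iff_add_eq]
      simp only [sub_eq_zero, e] at h
      rw [sub_right_comm i (cornerLetter N b) 1, sub_add_eq_add_sub] at h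
      have h' := congrArg (δ b * ·) h
      simp only [mul_add, mul_sub, mul_ite, mul_one, mul_zero] at h'
      linear_combination h'
    rw [hXd, hXd, hXd, ← Finset.sum_add_distrib, ← Finset.sum_congr rfl fun b _ => h1 b,
      Finset.sum_sub_distrib, Finset.sum_sub_distrib, ← Finset.mul_sum]
    ring
  refine ⟨X, fun i => (X (i - 1) + X i) / (1 + c) + ∑ b, if i = cornerLetter N b then δ b else 0,
    fun a => ?_, fun i hi => ?_, fun i => ?_, fun a => ?_⟩ <;> beta_reduce
  · rw [← hX a]
    congr 1
    rw [Finset.sum_eq_single a]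
    · rw [if_pos rfl]
    · intro b _ hb
      exact if_neg fun h => hb (cornerLetter_injective N h).symm
    · simp
  · rw [Finset.sum_eq_zero fun b _ => if_neg (hi b), h1z]
    field_simp
    ring
  · have h := hL i
    simp only [add_sub_cancel_right]
    rw [h1z]
    obtain ⟨S1, hS1⟩ : ∃ s, s = ∑ b, if i = cornerLetter N b then δ b else 0 := ⟨_, rfl⟩
    obtain ⟨S2, hS2⟩ : ∃ s, s = ∑ b, if i + 1 = cornerLetter N b then δ b else 0 := ⟨_, rfl⟩
    rw [← hS1, ← hS2] at h ⊢
    field_simp at h ⊢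
    linear_combination 2 * h
  -- Comparing the coefficients of `g a` and of `S` amounts to `(1 + c) α = φ (3 - 2r)` and `(1 + c)
  -- β = -φ`.
  · rw [Finset.sum_erase_eq_sub (Finset.mem_univ a), ← hS]
    have h1 : (1 - z) * g a - (X (cornerLetter N a - 1) + X (cornerLetter N a)) / 2 =
        (1 - z) * δ a := by
      rw [h1z, ← hX a]
      field_simp
      ring
    rw [h1, h1z, h3z]
    rw [hδ]
    rw [hα, hβ]
    field_simp
    ring

/-! ### The polynomials in `z` behind `R` and `φ` -/

open Polynomial Polynomial.Chebyshev in
/-- The polynomial `T_N(1 - 2z)` in `z`. -/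
noncomputable def tPoly (N : ℕ) : ℂ[X] := (Chebyshev.T ℂ N).comp (1 - 2 * X)

open Polynomial Polynomial.Chebyshev in
/-- The polynomial `U_{N-1}(1 - 2z)` in `z`. -/
noncomputable def uPoly (N : ℕ) : ℂ[X] := (Chebyshev.U ℂ (N - 1)).comp (1 - 2 * X)

/-- The polynomial `2 T_N(1 - 2z) + 2 U_{N-1}(1 - 2z) + 1` in `z`. -/
noncomputable def gPoly (N : ℕ) : Polynomial ℂ := 2 * tPoly N + 2 * uPoly N + 1

open Polynomial Polynomial.Chebyshev in
/-- The polynomial `q` with `q(w²) = T_N(w)` for even `N` and `q(w²) = U_{N-1}(w)` for odd `N`. -/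
noncomputable def qPoly (N : ℕ) : ℂ[X] :=
  if Even N then (Chebyshev.T ℂ (N / 2 : ℕ)).comp (2 * X - 1)
  else (Chebyshev.U ℂ (N / 2 : ℕ) + Chebyshev.U ℂ ((N / 2 : ℕ) - 1)).comp (2 * X - 1)

open Polynomial Polynomial.Chebyshev in
/-- The polynomial `p` with `p(w²) = (w² - 1) w U_{N-1}(w)` for even `N` and `p(w²) = w T_N(w)` for
odd `N`. -/
noncomputable def pPoly (N : ℕ) : ℂ[X] :=
  if Even N then 2 * X * (X - 1) * (Chebyshev.U ℂ ((N / 2 : ℕ) - 1)).comp (2 * X - 1)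
  else Polynomial.C (1 / 2) *
    (Chebyshev.T ℂ ((N / 2 : ℕ) + 1) + Chebyshev.T ℂ (N / 2 : ℕ)).comp (2 * X - 1)

theorem eval_tPoly (N : ℕ) (z : ℂ) :
    (tPoly N).eval z = (Polynomial.Chebyshev.T ℂ N).eval (1 - 2 * z) := by
  simp [tPoly]

theorem eval_uPoly (N : ℕ) (z : ℂ) :
    (uPoly N).eval z = (Polynomial.Chebyshev.U ℂ (N - 1)).eval (1 - 2 * z) := by
  simp [uPoly]

theorem eval_gPoly (N : ℕ) (z : ℂ) :
    (gPoly N).eval z = 2 * (tPoly N).eval z + 2 * (uPoly N).eval z + 1 := by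
  simp [gPoly]

/-- For `w = cos θ` this is `sin((2m + 2)θ) + sin(2mθ) = 2 sin((2m + 1)θ) cos θ` divided by `sin
2θ`. The induction uses that both sides satisfy the recurrence with factor `4w² - 2`. -/
theorem chebyshev_U_two_mul (m : ℕ) (w : ℂ) :
    (Polynomial.Chebyshev.U ℂ (2 * m)).eval w =
      (Polynomial.Chebyshev.U ℂ m).eval (2 * w ^ 2 - 1) +
        (Polynomial.Chebyshev.U ℂ (m - 1)).eval (2 * w ^ 2 - 1) := by
  induction m using Nat.twoStepInduction with
  | zero => simp
  | one =>
    simp [Polynomial.Chebyshev.U_two]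
    ring
  | more m ih1 ih2 =>
    have h1 := congrArg (Polynomial.eval w) (Polynomial.Chebyshev.U_add_two ℂ (2 * m + 2))
    have h2 := congrArg (Polynomial.eval w) (Polynomial.Chebyshev.U_add_two ℂ (2 * m + 1))
    have h3 := congrArg (Polynomial.eval w) (Polynomial.Chebyshev.U_add_two ℂ (2 * m))
    have h4 := congrArg (Polynomial.eval (2 * w ^ 2 - 1)) (Polynomial.Chebyshev.U_add_two ℂ m)
    have h5 := congrArg (Polynomial.eval (2 * w ^ 2 - 1)) (Polynomial.Chebyshev.U_add_one ℂ m)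
    simp only [Polynomial.eval_sub, Polynomial.eval_mul, Polynomial.eval_X,
      Polynomial.eval_ofNat] at h1 h2 h3 h4 h5
    push_cast at ih2 ⊢
    rw [show (2 * ((m : ℤ) + 1)) = 2 * m + 2 by ring, show (m : ℤ) + 1 - 1 = m by ring] at ih2
    rw [show (2 * ((m : ℤ) + 2)) = 2 * m + 2 + 2 by ring, show (m : ℤ) + 2 - 1 = m + 1 by ring]
    rw [show (2 * m + 2 + 1 : ℤ) = 2 * m + 1 + 2 by ring] at h1
    rw [show (2 * m + 1 + 1 : ℤ) = 2 * m + 2 by ring] at h2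
    linear_combination h1 + 2 * w * h2 + h3 + (4 * w ^ 2 - 2) * ih2 - ih1 - h4 - h5

theorem eval_qPoly_of_even {N : ℕ} (hN : Even N) (w : ℂ) :
    (qPoly N).eval (w ^ 2) = (Polynomial.Chebyshev.T ℂ N).eval w := by
  obtain ⟨m, rfl⟩ := hN.two_dvd
  rw [qPoly, if_pos hN, Nat.mul_div_cancel_left m two_pos,
    show ((2 * m : ℕ) : ℤ) = m * 2 by push_cast; ring, Polynomial.Chebyshev.T_mul]
  simp [Polynomial.Chebyshev.T_two]

theorem eval_qPoly_of_odd {N : ℕ} (hN : ¬ Even N) (w : ℂ) :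
    (qPoly N).eval (w ^ 2) = (Polynomial.Chebyshev.U ℂ (N - 1)).eval w := by
  obtain ⟨m, rfl⟩ := Nat.not_even_iff_odd.1 hN
  rw [qPoly, if_neg hN, show (2 * m + 1) / 2 = m by omega]
  push_cast
  rw [add_sub_cancel_right, chebyshev_U_two_mul]
  simp

theorem eval_pPoly_of_even {N : ℕ} (hN : Even N) (w : ℂ) :
    (pPoly N).eval (w ^ 2) =
      (w ^ 2 - 1) * w * (Polynomial.Chebyshev.U ℂ (N - 1)).eval w := by
  obtain ⟨m, rfl⟩ := hN.two_dvd
  rw [pPoly, if_pos hN, Nat.mul_div_cancel_left m two_pos]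
  obtain ⟨θ, rfl⟩ := Complex.cos_surjective w
  have h1 := Polynomial.Chebyshev.U_complex_cos θ ((2 * m : ℕ) - 1)
  have h2 := Polynomial.Chebyshev.U_complex_cos (2 * θ) (m - 1)
  rw [Complex.cos_two_mul, Complex.sin_two_mul] at h2
  have hs := Complex.sin_sq_add_cos_sq θ
  push_cast at h1 h2
  rw [sub_add_cancel] at h1 h2
  rw [show (m : ℂ) * (2 * θ) = 2 * m * θ by ring, ← h1] at h2
  simp
  rw [show Complex.cos θ ^ 2 - 1 = - Complex.sin θ * Complex.sin θ by linear_combination hs]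
  linear_combination -Complex.cos θ * Complex.sin θ * h2

theorem eval_pPoly_of_odd {N : ℕ} (hN : ¬ Even N) (w : ℂ) :
    (pPoly N).eval (w ^ 2) = w * (Polynomial.Chebyshev.T ℂ N).eval w := by
  obtain ⟨m, rfl⟩ := Nat.not_even_iff_odd.1 hN
  rw [pPoly, if_neg hN, show (2 * m + 1) / 2 = m by omega]
  obtain ⟨θ, rfl⟩ := Complex.cos_surjective w
  have h1 := Polynomial.Chebyshev.T_complex_cos (2 * θ) (m + 1)
  have h2 := Polynomial.Chebyshev.T_complex_cos (2 * θ) m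
  rw [Complex.cos_two_mul] at h1 h2
  have h3 := Complex.cos_add ((2 * m + 1) * θ) θ
  have h4 := Complex.cos_sub ((2 * m + 1) * θ) θ
  rw [show (2 * m + 1) * θ + θ = (m + 1) * (2 * θ) by ring] at h3
  rw [show (2 * m + 1) * θ - θ = m * (2 * θ) by ring] at h4
  push_cast at h1 h2
  rw [Polynomial.Chebyshev.T_complex_cos]
  simp
  rw [h1, h2, h3, h4]
  ring

theorem sin_ne_zero_of_cos_sq {θ : ℂ} (h : Complex.cos θ ^ 2 ≠ 1) : Complex.sin θ ≠ 0 := by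
  intro hs
  apply h
  have := Complex.sin_sq_add_cos_sq θ
  rw [hs] at this
  linear_combination this

theorem one_sub_two_mul_cos_sq (θ : ℂ) :
    1 - 2 * Complex.cos θ ^ 2 = -Complex.cos (2 * θ) := by
  rw [Complex.cos_two_mul]; ring

theorem eval_tPoly_cos_sq (N : ℕ) (θ : ℂ) :
    (tPoly N).eval (Complex.cos θ ^ 2) =
      (if Even N then 1 else -1) * Complex.cos (2 * (N * θ)) := by
  rw [eval_tPoly, one_sub_two_mul_cos_sq, Polynomial.Chebyshev.T_eval_neg,
    Polynomial.Chebyshev.T_complex_cos]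
  push_cast
  rw [show (N : ℂ) * (2 * θ) = 2 * (N * θ) by ring]
  split_ifs with h
  · rw [Int.negOnePow_even _ (by exact_mod_cast h)]; simp
  · rw [Int.negOnePow_odd _ (by exact_mod_cast Nat.not_even_iff_odd.1 h)]; simp

theorem eval_uPoly_cos_sq (N : ℕ) [NeZero N] (θ : ℂ) :
    (uPoly N).eval (Complex.cos θ ^ 2) * Complex.sin (2 * θ) =
      (if Even N then -1 else 1) * Complex.sin (2 * (N * θ)) := by
  obtain ⟨m, rfl⟩ : ∃ m, N = m + 1 := Nat.exists_eq_succ_of_ne_zero (NeZero.ne N)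
  rw [eval_uPoly, one_sub_two_mul_cos_sq, show (((m + 1 : ℕ) : ℤ) - 1) = (m : ℤ) by push_cast; ring,
    Polynomial.Chebyshev.U_eval_neg, mul_assoc, Polynomial.Chebyshev.U_complex_cos]
  push_cast
  rw [show ((m : ℂ) + 1) * (2 * θ) = 2 * ((m + 1) * θ) by ring]
  split_ifs with h
  · rw [Nat.even_add_one, Nat.not_even_iff_odd] at h
    rw [Int.negOnePow_odd _ (by exact_mod_cast h)]; simp
  · rw [Nat.even_add_one, not_not] at h
    rw [Int.negOnePow_even _ (by exact_mod_cast h)]; simp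

theorem chebyshev_U_pred_cos (N : ℕ) (θ : ℂ) :
    (Polynomial.Chebyshev.U ℂ (N - 1)).eval (Complex.cos θ) * Complex.sin θ =
      Complex.sin (N * θ) := by
  rw [Polynomial.Chebyshev.U_complex_cos]
  push_cast
  rw [sub_add_cancel]

theorem chebyshev_T_cos (N : ℕ) (θ : ℂ) :
    (Polynomial.Chebyshev.T ℂ N).eval (Complex.cos θ) = Complex.cos (N * θ) := by
  rw [Polynomial.Chebyshev.T_complex_cos]
  push_cast
  rfl

theorem exists_cos_sq_eq (z : ℂ) : ∃ θ, Complex.cos θ ^ 2 = z := by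
  obtain ⟨w, rfl⟩ := IsAlgClosed.exists_pow_nat_eq z two_pos
  obtain ⟨θ, rfl⟩ := Complex.cos_surjective w
  exact ⟨θ, rfl⟩

/-- For `z = cos² θ` one has `1 - 2z = -cos 2θ`, hence `t = ±cos 2Nθ` and `u sin 2θ = ∓sin 2Nθ`,
with upper signs for even `N`. The half-angle formulas reduce `(1 - t) / (2u)` to `-tan(Nθ) sin θ
cos θ` for even and `cot(Nθ) sin θ cos θ` for odd `N`, which is `p / q`. -/
theorem two_mul_u_mul_p {N : ℕ} [NeZero N] {z : ℂ} (hz : z ≠ 1) :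
    2 * (uPoly N).eval z * (pPoly N).eval z = (1 - (tPoly N).eval z) * (qPoly N).eval z := by
  obtain ⟨θ, rfl⟩ := exists_cos_sq_eq z
  have hs := sin_ne_zero_of_cos_sq hz
  have hu := eval_uPoly_cos_sq N θ
  have hU := chebyshev_U_pred_cos N θ
  have hs1 := Complex.sin_sq_add_cos_sq θ
  have hs2 := Complex.sin_sq_add_cos_sq (N * θ)
  rw [eval_tPoly_cos_sq]
  rw [Complex.sin_two_mul, Complex.sin_two_mul] at hu
  rw [Complex.cos_two_mul]
  by_cases hN : Even N
  · rw [eval_qPoly_of_even hN, eval_pPoly_of_even hN, chebyshev_T_cos]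
    rw [if_pos hN] at hu ⊢
    rw [show Complex.cos θ ^ 2 - 1 = - Complex.sin θ * Complex.sin θ by linear_combination hs1]
    linear_combination -2 * Complex.sin θ * Complex.cos θ *
      (uPoly N).eval (Complex.cos θ ^ 2) * hU - Complex.sin (N * θ) * hu +
      2 * Complex.cos (N * θ) * hs2
  · rw [eval_qPoly_of_odd hN, eval_pPoly_of_odd hN, chebyshev_T_cos]
    rw [if_neg hN] at hu ⊢
    apply mul_right_cancel₀ hs
    linear_combination Complex.cos (N * θ) * hu - 2 * Complex.cos (N * θ) ^ 2 * hU

/-! ### Roots of `q` -/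

/-- Reduction of an angle modulo `π` and sign. -/
theorem exists_nat_cos_sq_eq {N : ℕ} (hN : 0 < N) (j : ℤ) :
    ∃ m : ℕ, m ≤ N ∧ (Odd m ↔ Odd j) ∧
      Complex.cos (j * Real.pi / (2 * N)) ^ 2 = Complex.cos (m * Real.pi / (2 * N)) ^ 2 := by
  have hN' : (N : ℂ) ≠ 0 := Nat.cast_ne_zero.2 hN.ne'
  obtain ⟨r, hr⟩ := Int.eq_ofNat_of_zero_le (Int.emod_nonneg j (show (2 * N : ℤ) ≠ 0 by omega))
  have hlt := Int.emod_lt_of_pos j (show (0 : ℤ) < 2 * N by omega)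
  obtain ⟨s, hs⟩ : ∃ s, s = j / (2 * N) := ⟨_, rfl⟩
  have hj : j = r + 2 * N * s := by rw [hs, ← hr]; exact (Int.emod_add_mul_ediv j _).symm
  have hcos : Complex.cos (j * Real.pi / (2 * N)) ^ 2 =
      Complex.cos (r * Real.pi / (2 * N)) ^ 2 := by
    have e : (j : ℂ) * Real.pi / (2 * N) = r * Real.pi / (2 * N) + s * Real.pi := by
      rw [hj]; push_cast; field_simp
    have h1 := Complex.cos_sq (j * Real.pi / (2 * N))
    have h2 := Complex.cos_sq (r * Real.pi / (2 * N))
    rw [h1, h2, e, mul_add, show 2 * ((s : ℂ) * Real.pi) = s * (2 * Real.pi) by ring,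
      Complex.cos_add_int_mul_two_pi]
  by_cases hrN : r ≤ N
  · refine ⟨r, hrN, ?_, hcos⟩
    rw [hj, ← Int.odd_coe_nat]
    simp [Int.odd_add, mul_assoc]
  · refine ⟨2 * N - r, by omega, ?_, ?_⟩
    · rw [hj, ← Int.odd_coe_nat, Nat.cast_sub (by omega)]
      have h3 : ¬ Odd (2 * (N : ℤ)) := Int.not_odd_iff_even.2 (even_two_mul _)
      simp [Int.odd_add, Int.odd_sub, mul_assoc, h3]
    · rw [hcos, Nat.cast_sub (by omega)]
      push_cast
      rw [show (2 * (N : ℂ) - r) * Real.pi / (2 * N) = Real.pi - r * Real.pi / (2 * N) by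
        field_simp, Complex.cos_pi_sub, neg_sq]

theorem eval_qPoly_one_ne_zero (N : ℕ) [NeZero N] : (qPoly N).eval 1 ≠ 0 := by
  rw [← one_pow 2]
  by_cases hN : Even N
  · rw [eval_qPoly_of_even hN, Polynomial.Chebyshev.T_eval_one]
    exact one_ne_zero
  · rw [eval_qPoly_of_odd hN, Polynomial.Chebyshev.U_eval_one]
    push_cast
    rw [sub_add_cancel]
    exact Nat.cast_ne_zero.2 (NeZero.ne N)

theorem eval_qPoly_zero_ne_zero (N : ℕ) : (qPoly N).eval 0 ≠ 0 := by
  have h0 : (qPoly N).eval 0 = (qPoly N).eval (0 ^ 2) := by simp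
  rw [h0]
  by_cases hN : Even N
  · rw [eval_qPoly_of_even hN, Polynomial.Chebyshev.T_eval_zero_of_even ℂ (by exact_mod_cast hN)]
    simp
  · rw [eval_qPoly_of_odd hN, Polynomial.Chebyshev.U_eval_zero_of_even]
    · simp
    · have : Odd (N : ℤ) := by exact_mod_cast Nat.not_even_iff_odd.1 hN
      exact this.sub_odd odd_one

theorem eval_pPoly_zero (N : ℕ) : (pPoly N).eval 0 = 0 := by
  rw [← zero_pow two_ne_zero]
  by_cases hN : Even N
  · rw [eval_pPoly_of_even hN]; simp
  · rw [eval_pPoly_of_odd hN]; simp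

theorem mem_poleSet_of_eval_qPoly_eq_zero {N : ℕ} [NeZero N] {c : ℂ}
    (hc : (qPoly N).eval c = 0) : c ∈ poleSet N := by
  have hN0 := NeZero.pos N
  have hN' : (N : ℂ) ≠ 0 := Nat.cast_ne_zero.2 hN0.ne'
  obtain ⟨θ, rfl⟩ := exists_cos_sq_eq c
  have hc1 : Complex.cos θ ^ 2 ≠ 1 := fun h => eval_qPoly_one_ne_zero N (h ▸ hc)
  have key : ∃ j : ℤ, θ = j * Real.pi / (2 * N) ∧ (Odd j ↔ Even N) := by
    by_cases hN : Even N
    · rw [eval_qPoly_of_even hN, chebyshev_T_cos, Complex.cos_eq_zero_iff] at hc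
      obtain ⟨k, hk⟩ := hc
      refine ⟨2 * k + 1, ?_, by simp [hN]⟩
      push_cast
      field_simp
      linear_combination 2 * hk
    · rw [eval_qPoly_of_odd hN] at hc
      have := chebyshev_U_pred_cos N θ
      rw [hc, zero_mul, eq_comm, Complex.sin_eq_zero_iff] at this
      obtain ⟨k, hk⟩ := this
      refine ⟨2 * k, ?_, by simp [hN]⟩
      push_cast
      field_simp
      linear_combination hk
  obtain ⟨j, rfl, hj⟩ := key
  obtain ⟨m, hm, hmo, e⟩ := exists_nat_cos_sq_eq hN0 j
  rw [e] at hc1 ⊢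
  refine ⟨m, ?_, ?_, ?_, ?_, ?_⟩
  · rcases Nat.eq_zero_or_pos m with rfl | h
    · simp at hc1
    · exact h
  -- The end point `m = N` has the wrong parity, and `m = 0` was excluded by `q(1) ≠ 0`.
  · refine lt_of_le_of_ne hm ?_
    rintro rfl
    rw [← Nat.not_odd_iff_even] at hj
    tauto
  · intro h; exact hmo.2 (hj.2 h)
  · intro h
    rw [← Nat.not_odd_iff_even, hmo, hj, Nat.not_even_iff_odd]
    exact h
  · push_cast; rfl

theorem poleSet_spec {N : ℕ} {c : ℂ} (hc : c ∈ poleSet N) :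
    ∃ θ : ℂ, c = Complex.cos θ ^ 2 ∧ Complex.cos θ ≠ 0 ∧ Complex.sin θ ≠ 0 ∧
      (if Even N then Complex.cos (N * θ) = 0 else Complex.sin (N * θ) = 0) := by
  obtain ⟨m, h1, h2, h3, h4, rfl⟩ := hc
  have hN : (0 : ℝ) < N := by exact_mod_cast (by omega : 0 < N)
  have hm : (0 : ℝ) < m := by exact_mod_cast h1
  have hmN : (m : ℝ) < N := by exact_mod_cast h2
  have hN' : (N : ℂ) ≠ 0 := by exact_mod_cast hN.ne'
  have hpos : 0 < m * Real.pi / (2 * N) := by positivity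
  have hlt : m * Real.pi / (2 * N) < Real.pi / 2 := by
    rw [div_lt_div_iff₀ (by positivity) two_pos]
    nlinarith [Real.pi_pos]
  refine ⟨((m * Real.pi / (2 * N) : ℝ) : ℂ), by push_cast; rfl, ?_, ?_, ?_⟩
  · rw [← Complex.ofReal_cos]
    exact_mod_cast (Real.cos_pos_of_mem_Ioo ⟨by linarith, hlt⟩).ne'
  · rw [← Complex.ofReal_sin]
    exact_mod_cast (Real.sin_pos_of_pos_of_lt_pi hpos (by linarith [Real.pi_pos])).ne'
  · have e : (N : ℂ) * ((m * Real.pi / (2 * N) : ℝ) : ℂ) = m * Real.pi / 2 := by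
      push_cast; field_simp
    rw [e]
    split_ifs with hE
    · obtain ⟨k, rfl⟩ := h3 hE
      rw [Complex.cos_eq_zero_iff]
      exact ⟨k, by push_cast; ring⟩
    · obtain ⟨k, rfl⟩ := h4 (Nat.not_even_iff_odd.1 hE)
      rw [Complex.sin_eq_zero_iff]
      exact ⟨k, by push_cast; ring⟩

/-- At these angles `sin 2Nθ = 0` and `t = -1`, so `u = 0` and `G = -1`. Since `cos Nθ` and `sin Nθ`
do not vanish together, `p` is nonzero. The derivative is read off from `q(w²)`, which is `T_N(w)`
or `U_{N-1}(w)`. -/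
theorem eval_of_mem_poleSet {N : ℕ} [NeZero N] {c : ℂ} (hc : c ∈ poleSet N) :
    (qPoly N).eval c = 0 ∧ (pPoly N).eval c ≠ 0 ∧ (gPoly N).eval c ≠ 0 ∧
      (Polynomial.derivative (qPoly N)).eval c ≠ 0 := by
  obtain ⟨θ, rfl, hcos, hsin, hN⟩ := poleSet_spec hc
  have hn : (N : ℂ) ≠ 0 := Nat.cast_ne_zero.2 (NeZero.ne N)
  have ht := eval_tPoly_cos_sq N θ
  have hu := eval_uPoly_cos_sq N θ
  have hU := chebyshev_U_pred_cos N θ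
  have hT := chebyshev_T_cos N θ
  have hs1 := Complex.sin_sq_add_cos_sq θ
  have hs2 := Complex.sin_sq_add_cos_sq (N * θ)
  rw [Complex.sin_two_mul, Complex.sin_two_mul] at hu
  rw [Complex.cos_two_mul] at ht
  have hg : (tPoly N).eval (Complex.cos θ ^ 2) = -1 → (gPoly N).eval (Complex.cos θ ^ 2) ≠ 0 := by
    intro h
    have hu0 : (uPoly N).eval (Complex.cos θ ^ 2) = 0 := by
      have : (uPoly N).eval (Complex.cos θ ^ 2) * (2 * Complex.sin θ * Complex.cos θ) = 0 := by
        rw [hu]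
        split_ifs at hN <;> rw [hN] <;> ring
      simpa [hcos, hsin] using this
    rw [eval_gPoly, h, hu0]
    norm_num
  by_cases hE : Even N
  · rw [if_pos hE] at hN ht
    rw [hN] at hs2 ht hT
    have hsN : Complex.sin (N * θ) ≠ 0 := by
      intro h; rw [h] at hs2; norm_num at hs2
    have hU0 : (Polynomial.Chebyshev.U ℂ (N - 1)).eval (Complex.cos θ) ≠ 0 := by
      intro h; rw [h, zero_mul] at hU; exact hsN hU.symm
    refine ⟨by rw [eval_qPoly_of_even hE, hT], ?_, hg (by rw [ht]; ring), ?_⟩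
    · rw [eval_pPoly_of_even hE,
        show Complex.cos θ ^ 2 - 1 = - Complex.sin θ * Complex.sin θ by linear_combination hs1]
      simp [hcos, hsin, hU0]
    · intro h
      have hcomp : (qPoly N).comp (Polynomial.X ^ 2) = Polynomial.Chebyshev.T ℂ N :=
        Polynomial.funext fun w => by simp [eval_qPoly_of_even hE]
      have hd := congrArg (fun f => (Polynomial.derivative f).eval (Complex.cos θ)) hcomp
      simp [Polynomial.derivative_comp, h, Polynomial.Chebyshev.T_derivative_eq_U, hU0, hn] at hd
  · rw [if_neg hE] at hN ht
    rw [hN] at hs2 hU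
    have hcN : Complex.cos (N * θ) ≠ 0 := by
      intro h; rw [h] at hs2; norm_num at hs2
    have hU0 : (Polynomial.Chebyshev.U ℂ (N - 1)).eval (Complex.cos θ) = 0 :=
      (mul_eq_zero.1 hU).resolve_right hsin
    refine ⟨by rw [eval_qPoly_of_odd hE, hU0], ?_, hg ?_, ?_⟩
    · rw [eval_pPoly_of_odd hE, hT]
      exact mul_ne_zero hcos hcN
    · rw [ht]; linear_combination -2 * hs2
    · intro h
      have hcomp : (qPoly N).comp (Polynomial.X ^ 2) = Polynomial.Chebyshev.U ℂ (N - 1) :=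
        Polynomial.funext fun w => by simp [eval_qPoly_of_odd hE]
      have hd := congrArg (fun f => (Polynomial.derivative f).eval (Complex.cos θ)) hcomp
      have hd' : (Polynomial.derivative (Polynomial.Chebyshev.U ℂ (N - 1))).eval (Complex.cos θ) =
          0 := by
        rw [← hd]; simp [Polynomial.derivative_comp, h]
      -- `N T_N` is a combination of `U_{N-1}` and its derivative, so a double root would force `T_N
      -- = 0`.
      have hr := congrArg (Polynomial.eval (Complex.cos θ))
        (Polynomial.Chebyshev.add_one_mul_T_eq_poly_in_U (R := ℂ) (N - 1))
      simp [hd', hU0, hT, hn, hcN] at hr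

/-! ### Rational functions: evaluation, equality, lowest terms -/

open Filter Topology

theorem eventually_eval_ne_zero {p : Polynomial ℂ} (hp : p ≠ 0) :
    ∀ᶠ z in cofinite, p.eval z ≠ 0 := by
  have := (p.roots.toFinset).finite_toSet
  refine (this.subset fun z hz => ?_ : {z | ¬ p.eval z ≠ 0}.Finite)
  simpa [hp] using hz

/-- The fraction need not be reduced: its reduced denominator divides `q`, so it does not vanish at
`a` either. -/
theorem ratFunc_eval_div {L : Type} [Field L] (f : ℂ →+* L) (a : L) (p : Polynomial ℂ)
    {q : Polynomial ℂ} (hq : q.eval₂ f a ≠ 0) :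
    (algebraMap (Polynomial ℂ) (RatFunc ℂ) p / algebraMap (Polynomial ℂ) (RatFunc ℂ) q).eval f a =
      p.eval₂ f a / q.eval₂ f a := by
  have hq0 : q ≠ 0 := by rintro rfl; simp at hq
  have h := congrArg (Polynomial.eval₂ f a) ((RatFunc.num_mul_eq_mul_denom_iff hq0).2
    (rfl : algebraMap (Polynomial ℂ) (RatFunc ℂ) p / algebraMap _ _ q = _))
  rw [Polynomial.eval₂_mul, Polynomial.eval₂_mul] at h
  have hd : Polynomial.eval₂ f a (algebraMap (Polynomial ℂ) (RatFunc ℂ) p /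
      algebraMap (Polynomial ℂ) (RatFunc ℂ) q).denom ≠ 0 := by
    intro h0
    obtain ⟨r, hr⟩ := RatFunc.denom_div_dvd p q
    rw [hr, Polynomial.eval₂_mul, h0, zero_mul] at hq
    exact hq rfl
  rw [RatFunc.eval, div_eq_div_iff hd hq, h]

theorem atSq_div (p : Polynomial ℂ) {q : Polynomial ℂ} (hq : q ≠ 0) :
    atSq (algebraMap (Polynomial ℂ) (RatFunc ℂ) p / algebraMap _ _ q) =
      algebraMap (Polynomial ℂ) (RatFunc ℂ) (p.comp (Polynomial.X ^ 2)) /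
        algebraMap _ _ (q.comp (Polynomial.X ^ 2)) := by
  have key : ∀ r : Polynomial ℂ, r.eval₂ (RatFunc.C : ℂ →+* RatFunc ℂ) (RatFunc.X ^ 2) =
      algebraMap _ _ (r.comp (Polynomial.X ^ 2)) := by
    intro r
    rw [Polynomial.comp, Polynomial.hom_eval₂, map_pow, RatFunc.algebraMap_X,
      RatFunc.algebraMap_comp_C]
  have hq' : q.comp (Polynomial.X ^ 2) ≠ 0 := by
    rw [Ne, Polynomial.comp_eq_zero_iff]
    rintro (h | ⟨-, h⟩)
    · exact hq h
    · have := congrArg Polynomial.natDegree h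
      simp at this
  rw [atSq, ratFunc_eval_div, key, key]
  rw [key]
  exact RatFunc.algebraMap_ne_zero hq'

theorem ratFunc_eq_of_eventually_eval_eq {f g : RatFunc ℂ}
    (h : ∀ᶠ z in cofinite, f.eval (RingHom.id ℂ) z = g.eval (RingHom.id ℂ) z) : f = g := by
  have h1 : f.num * g.denom = g.num * f.denom := by
    refine Polynomial.eq_of_infinite_eval_eq _ _ (Filter.frequently_cofinite_iff_infinite.1
      (Filter.Eventually.frequently ?_))
    filter_upwards [h, eventually_eval_ne_zero f.denom_ne_zero,
      eventually_eval_ne_zero g.denom_ne_zero] with z h1 h2 h3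
    rw [RatFunc.eval, RatFunc.eval, Polynomial.eval₂_id, Polynomial.eval₂_id, Polynomial.eval₂_id,
      Polynomial.eval₂_id, div_eq_div_iff h2 h3] at h1
    simpa using h1
  rw [(RatFunc.num_mul_eq_mul_denom_iff g.denom_ne_zero).1 h1, RatFunc.num_div_denom]

theorem denom_associated {p q : Polynomial ℂ} (hq : q ≠ 0) (h : IsCoprime p q) :
    Associated (algebraMap (Polynomial ℂ) (RatFunc ℂ) p / algebraMap _ _ q).denom q := by
  refine associated_of_dvd_dvd (RatFunc.denom_div_dvd p q) ?_
  refine h.symm.dvd_of_dvd_mul_left ?_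
  rw [← (RatFunc.num_mul_eq_mul_denom_iff hq).2 rfl]
  exact dvd_mul_left _ _

theorem num_associated {p q : Polynomial ℂ} (hq : q ≠ 0) (h : IsCoprime p q) :
    Associated (algebraMap (Polynomial ℂ) (RatFunc ℂ) p / algebraMap _ _ q).num p := by
  have e := (RatFunc.num_mul_eq_mul_denom_iff hq).2
    (rfl : algebraMap (Polynomial ℂ) (RatFunc ℂ) p / algebraMap _ _ q = _)
  refine associated_of_dvd_dvd ?_ ?_
  · refine (RatFunc.isCoprime_num_denom _).dvd_of_dvd_mul_right ?_
    rw [← e]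
    exact dvd_mul_right _ _
  · refine h.dvd_of_dvd_mul_right ?_
    rw [e]
    exact dvd_mul_right _ _

theorem isRoot_iff_of_associated {p q : Polynomial ℂ} (h : Associated p q) (c : ℂ) :
    p.IsRoot c ↔ q.IsRoot c := by
  rw [← Polynomial.dvd_iff_isRoot, ← Polynomial.dvd_iff_isRoot, h.dvd_iff_dvd_right]

/-! ### The pair `R`, `φ` and its generic validity -/

/-- The rational function `R`. -/
noncomputable def ratR (N : ℕ) : RatFunc ℂ :=
  algebraMap (Polynomial ℂ) (RatFunc ℂ) (pPoly N * gPoly N) / algebraMap _ _ (qPoly N)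

/-- The rational function `φ`. -/
noncomputable def ratPhi (N : ℕ) : RatFunc ℂ :=
  algebraMap (Polynomial ℂ) (RatFunc ℂ) ((3 - 2 * Polynomial.X) * qPoly N) /
    algebraMap _ _ ((qPoly N - 2 * pPoly N) * gPoly N)

open Polynomial in
/-- The polynomial `jump N (1 - 2z)` in `z`. -/
noncomputable def jumpPoly (N : ℕ) : ℂ[X] :=
  (Chebyshev.U ℂ (-2) + Chebyshev.U ℂ (3 * N - 1) -
    (Chebyshev.U ℂ (-1) + Chebyshev.U ℂ (3 * N - 2))).comp (1 - 2 * X)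

theorem eval_jumpPoly (N : ℕ) (z : ℂ) : (jumpPoly N).eval z = jump N (1 - 2 * z) := by
  simp [jumpPoly, jump, symSol]
  ring_nf

theorem ne_zero_of_eval_ne_zero {p : Polynomial ℂ} {z : ℂ} (h : p.eval z ≠ 0) : p ≠ 0 := by
  rintro rfl
  simp at h

theorem qPoly_ne_zero (N : ℕ) : qPoly N ≠ 0 := ne_zero_of_eval_ne_zero (eval_qPoly_zero_ne_zero N)

theorem gPoly_ne_zero (N : ℕ) : gPoly N ≠ 0 := by
  refine ne_zero_of_eval_ne_zero (z := 0) ?_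
  rw [eval_gPoly, eval_tPoly, eval_uPoly, mul_zero, sub_zero, Polynomial.Chebyshev.T_eval_one,
    Polynomial.Chebyshev.U_eval_one]
  rw [show (2 * 1 + 2 * (((N - 1 : ℤ) : ℂ) + 1) + 1) = ((2 * N + 3 : ℕ) : ℂ) by push_cast; ring]
  exact Nat.cast_ne_zero.2 (by omega)

theorem qPoly_sub_ne_zero (N : ℕ) : qPoly N - 2 * pPoly N ≠ 0 := by
  refine ne_zero_of_eval_ne_zero (z := 0) ?_
  simp [eval_pPoly_zero, eval_qPoly_zero_ne_zero]

theorem uPoly_ne_zero (N : ℕ) [NeZero N] : uPoly N ≠ 0 := by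
  refine ne_zero_of_eval_ne_zero (z := 0) ?_
  rw [eval_uPoly, mul_zero, sub_zero, Polynomial.Chebyshev.U_eval_one]
  simp [NeZero.ne N]

theorem tPoly_add_uPoly_ne_zero (N : ℕ) [NeZero N] : uPoly N + tPoly N - 1 ≠ 0 := by
  refine ne_zero_of_eval_ne_zero (z := 0) ?_
  simp only [Polynomial.eval_sub, Polynomial.eval_add, eval_tPoly, eval_uPoly, mul_zero, sub_zero,
    Polynomial.Chebyshev.T_eval_one, Polynomial.Chebyshev.U_eval_one]
  simp [NeZero.ne N]

theorem jumpPoly_ne_zero (N : ℕ) [NeZero N] : jumpPoly N ≠ 0 := by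
  -- Here `c = -1` and the jump is `-6N` or `6N - 2`. The point `z = 0` used before would fail: the
  -- jump vanishes at `c = 1`.
  refine ne_zero_of_eval_ne_zero (z := 1) ?_
  have hN := NeZero.pos N
  have h3 : ((3 * N - 1 : ℤ)).negOnePow = -(3 * N - 2 : ℤ).negOnePow := by
    rw [← Int.negOnePow_succ]; ring_nf
  have e : (1 : ℂ) - 2 * 1 = -1 := by norm_num
  simp only [jumpPoly, Polynomial.eval_comp, Polynomial.eval_sub, Polynomial.eval_add,
    Polynomial.eval_mul, Polynomial.eval_one, Polynomial.eval_X, Polynomial.eval_ofNat, e,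
    Polynomial.Chebyshev.U_eval_neg_one, h3]
  rcases Int.units_eq_one_or (3 * N - 2 : ℤ).negOnePow with h | h <;> rw [h] <;>
    simp [Int.negOnePow_even] <;> intro h0 <;> ring_nf at h0
  · simp [hN.ne'] at h0
  · have h1 : ((N * 6 : ℕ) : ℂ) = (2 : ℕ) := by push_cast; linear_combination h0
    have h2 := Nat.cast_injective h1
    omega

/-- At all but finitely many points the rational functions solve the boundary value problem. -/
theorem eventually_hasLocalExtension (N : ℕ) [NeZero N] :
    ∀ᶠ z in cofinite, HasLocalExtension N z ((ratR N).eval (RingHom.id ℂ) z)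
      ((ratPhi N).eval (RingHom.id ℂ) z) ∧ (ratPhi N).eval (RingHom.id ℂ) z ≠ 0 := by
  have hX : (Polynomial.X : Polynomial ℂ) ≠ 0 := Polynomial.X_ne_zero
  have hX1 : (Polynomial.X - 1 : Polynomial ℂ) ≠ 0 :=
    ne_zero_of_eval_ne_zero (z := 0) (by simp)
  have hX3 : (3 - 2 * Polynomial.X : Polynomial ℂ) ≠ 0 :=
    ne_zero_of_eval_ne_zero (z := 0) (by simp)
  filter_upwards [eventually_eval_ne_zero hX, eventually_eval_ne_zero hX1,
    eventually_eval_ne_zero hX3, eventually_eval_ne_zero (uPoly_ne_zero N),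
    eventually_eval_ne_zero (gPoly_ne_zero N), eventually_eval_ne_zero (tPoly_add_uPoly_ne_zero N),
    eventually_eval_ne_zero (jumpPoly_ne_zero N), eventually_eval_ne_zero (qPoly_ne_zero N),
    eventually_eval_ne_zero (qPoly_sub_ne_zero N)] with z h0 h1 h3 hu hg hut hj hq hqp
  simp only [Polynomial.eval_sub, Polynomial.eval_add, Polynomial.eval_mul, Polynomial.eval_one,
    Polynomial.eval_X, Polynomial.eval_ofNat] at h0 h1 h3 hut hqp
  rw [sub_ne_zero] at h1
  -- This relation gives `p / q = (1 - t) / (2u)` and also `(q - 2p) / q = (u + t - 1) / u`, which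
  -- convert `R` and `φ` respectively.
  have hrel := two_mul_u_mul_p (N := N) h1
  rw [eval_jumpPoly] at hj
  have hR : (ratR N).eval (RingHom.id ℂ) z = (1 - (tPoly N).eval z) *
      (2 * (tPoly N).eval z + 2 * (uPoly N).eval z + 1) / (2 * (uPoly N).eval z) := by
    rw [ratR, ratFunc_eval_div _ _ _ (by simpa using hq)]
    simp only [Polynomial.eval₂_id, Polynomial.eval_mul]
    rw [div_eq_div_iff hq (mul_ne_zero two_ne_zero hu), ← eval_gPoly]
    linear_combination (gPoly N).eval z * hrel
  have hP : (ratPhi N).eval (RingHom.id ℂ) z = (3 - 2 * z) * (uPoly N).eval z /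
      (((uPoly N).eval z + (tPoly N).eval z - 1) *
        (2 * (tPoly N).eval z + 2 * (uPoly N).eval z + 1)) := by
    rw [ratPhi, ratFunc_eval_div _ _ _ (by simpa using ⟨hqp, hg⟩), ← eval_gPoly]
    simp only [Polynomial.eval₂_id, Polynomial.eval_mul, Polynomial.eval_sub, Polynomial.eval_X,
      Polynomial.eval_ofNat]
    rw [div_eq_div_iff (mul_ne_zero hqp hg) (mul_ne_zero hut hg)]
    linear_combination (3 - 2 * z) * (gPoly N).eval z * hrel
  rw [hR, hP]
  rw [eval_gPoly] at hg
  exact ⟨hasLocalExtension_of_ne (eval_tPoly N z).symm (eval_uPoly N z).symm h0 h1 h3 hu hg hut hj,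
    div_ne_zero (mul_ne_zero h3 hu) (mul_ne_zero hut hg)⟩

/-! ### The decimation identity and uniqueness -/

open Classical in
theorem blockD_eq (N n : ℕ) [NeZero N] (z : ℂ) :
    blockD N n z = (lap N (n + 1)).submatrix (new N n) (new N n) - z • 1 := by
  ext p q
  simp [blockD, shifted, Matrix.one_apply, new, (Set.inclusion_injective _).eq_iff]

open Classical in
theorem eventually_isUnit_det (N n : ℕ) [NeZero N] :
    ∀ᶠ z in cofinite, IsUnit (blockD N n z).det := by
  filter_upwards [eventually_eval_ne_zero (Matrix.charpoly_monic
    ((lap N (n + 1)).submatrix (new N n) (new N n))).ne_zero] with z hz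
  rw [Matrix.eval_charpoly] at hz
  rw [isUnit_iff_ne_zero, blockD_eq, ← neg_sub, Matrix.det_neg]
  refine mul_ne_zero (pow_ne_zero _ (neg_ne_zero.2 one_ne_zero)) ?_
  rwa [Matrix.smul_one_eq_diagonal]

theorem continuous_shifted (N n : ℕ) [NeZero N] : Continuous (shifted N n) := by
  classical
  exact continuous_const.sub (continuous_id.smul continuous_const)

theorem continuousAt_matrix_mul {l m n : Type*} [Fintype m] {f : ℂ → Matrix l m ℂ}
    {g : ℂ → Matrix m n ℂ} {z : ℂ} (hf : ContinuousAt f z) (hg : ContinuousAt g z) :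
    ContinuousAt (fun z => f z * g z) z := by
  have h : Continuous fun p : Matrix l m ℂ × Matrix m n ℂ => p.1 * p.2 :=
    continuous_fst.matrix_mul continuous_snd
  exact ContinuousAt.comp (g := fun p : Matrix l m ℂ × Matrix m n ℂ => p.1 * p.2)
    (f := fun z => (f z, g z)) h.continuousAt (hf.prodMk hg)

open Classical in
theorem continuousAt_inv_blockD (N n : ℕ) [NeZero N] {z : ℂ} (hz : IsUnit (blockD N n z).det) :
    ContinuousAt (fun z => (blockD N n z)⁻¹) z := by
  have hD : Continuous (blockD N n) := (continuous_shifted N n).matrix_submatrix _ _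
  have h1 : ContinuousAt (fun z => ((blockD N n z).det)⁻¹ • (blockD N n z).adjugate) z :=
    ContinuousAt.smul (hD.matrix_det.continuousAt.inv₀ hz.ne_zero) hD.matrix_adjugate.continuousAt
  refine h1.congr (Filter.Eventually.of_forall fun x => ?_)
  beta_reduce
  rw [Matrix.inv_def, Ring.inverse_eq_inv']

open Classical in
theorem continuousAt_schur (N n : ℕ) [NeZero N] {z : ℂ}
    (hinv : ContinuousAt (fun z => (blockD N n z)⁻¹) z) :
    ContinuousAt (schur N n) z := by
  have hs := continuous_shifted N n
  have h0 := (hs.matrix_submatrix (old N n) (old N n)).continuousAt (x := z)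
  have h1 := (hs.matrix_submatrix (old N n) (new N n)).continuousAt (x := z)
  have h2 := (hs.matrix_submatrix (new N n) (old N n)).continuousAt (x := z)
  have h3 := h0.sub (continuousAt_matrix_mul (continuousAt_matrix_mul h1 hinv) h2)
  exact h3

theorem continuousAt_ratFunc_eval {f : RatFunc ℂ} {z : ℂ} (hz : ¬ IsPole f z) :
    ContinuousAt (fun z => f.eval (RingHom.id ℂ) z) z := by
  simp only [RatFunc.eval, Polynomial.eval₂_id]
  exact f.num.continuous.continuousAt.div f.denom.continuous.continuousAt hz

/-- The local solution misses finitely many admissible `z`. Both sides are continuous where they are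
defined and agree on a punctured neighbourhood, hence also at the point itself. -/
theorem isDecimationPair_ratR_ratPhi (N n : ℕ) [NeZero N] :
    IsDecimationPair N n (ratR N) (ratPhi N) := by
  classical
  intro z hD hR hP
  have hc1 := continuousAt_schur N n (continuousAt_inv_blockD N n hD)
  have hc2 : ContinuousAt (fun z => (ratPhi N).eval (RingHom.id ℂ) z •
      (lap N n - (ratR N).eval (RingHom.id ℂ) z • (1 : Matrix (V N n) (V N n) ℂ))) z :=
    (continuousAt_ratFunc_eval hP).smul
      (continuousAt_const.sub ((continuousAt_ratFunc_eval hR).smul continuousAt_const))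
  have he : ∀ᶠ x in 𝓝[≠] z, schur N n x = (ratPhi N).eval (RingHom.id ℂ) x •
      (lap N n - (ratR N).eval (RingHom.id ℂ) x • (1 : Matrix (V N n) (V N n) ℂ)) := by
    filter_upwards [nhdsNE_le_cofinite z (eventually_isUnit_det N n),
      nhdsNE_le_cofinite z (eventually_hasLocalExtension N)] with x h1 h2
    exact schur_eq h2.1 h1
  exact tendsto_nhds_unique_of_eventuallyEq (hc1.tendsto.mono_left nhdsWithin_le_nhds)
    (hc2.tendsto.mono_left nhdsWithin_le_nhds) he

theorem exists_adj (N n : ℕ) [NeZero N] : ∃ x y, (graph N n).Adj x y := by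
  let w : Word N n := ⟨List.replicate n 0, by simp⟩
  exact ⟨⟨_, Fword_corner_mem w 0⟩, ⟨_, Fword_corner_mem w 1⟩,
    graph_adj_iff.2 ⟨(w, 0), mem_corners.2 rfl, 1,
      show (1 : Fin 3) ≠ 0 by decide, rfl⟩⟩

/-- `Δ_n` is not a scalar matrix: the entry at an edge determines `φ`, and then a diagonal entry
determines `R` because `φ` is generically nonzero. -/
theorem IsDecimationPair.unique {N n : ℕ} [NeZero N] {R' φ' : RatFunc ℂ}
    (h : IsDecimationPair N n R' φ') : R' = ratR N ∧ φ' = ratPhi N := by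
  classical
  have hpole : ∀ f : RatFunc ℂ, ∀ᶠ z in cofinite, ¬ IsPole f z := fun f =>
    eventually_eval_ne_zero f.denom_ne_zero
  obtain ⟨x, y, hxy⟩ := exists_adj N n
  have hne : x ≠ y := hxy.ne
  have hl : lap N n x y ≠ 0 := by
    have hd : ((graph N n).degree x : ℂ) ≠ 0 := by
      rw [degree_eq]
      exact mul_ne_zero two_ne_zero (card_corners_ne_zero x)
    simp only [lap, if_neg hne, if_pos hxy, zero_sub]
    exact neg_ne_zero.2 (inv_ne_zero hd)
  have hd : lap N n x x = 1 := by simp [lap]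
  have key : ∀ᶠ z in cofinite, φ'.eval (RingHom.id ℂ) z = (ratPhi N).eval (RingHom.id ℂ) z ∧
      R'.eval (RingHom.id ℂ) z = (ratR N).eval (RingHom.id ℂ) z := by
    filter_upwards [hpole R', hpole φ', hpole (ratR N), hpole (ratPhi N),
      eventually_isUnit_det N n, eventually_hasLocalExtension N] with z h1 h2 h3 h4 h5 h6
    have e := (h z h5 h1 h2).symm.trans (isDecimationPair_ratR_ratPhi N n z h5 h3 h4)
    have exy := congrFun (congrFun e x) y
    have exx := congrFun (congrFun e x) x
    simp only [Matrix.smul_apply, Matrix.sub_apply, Matrix.one_apply_ne hne, Matrix.one_apply_eq,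
      smul_eq_mul, mul_zero, sub_zero, mul_one, hd] at exy exx
    have e1 := mul_right_cancel₀ hl exy
    rw [e1] at exx
    have e2 := mul_left_cancel₀ h6.2 exx
    exact ⟨e1, by linear_combination -e2⟩
  exact ⟨ratFunc_eq_of_eventually_eval_eq (key.mono fun _ h => h.2),
    ratFunc_eq_of_eventually_eval_eq (key.mono fun _ h => h.1)⟩

theorem isDecimationPair_iff (N n : ℕ) [NeZero N] (R' φ' : RatFunc ℂ) :
    IsDecimationPair N n R' φ' ↔ R' = ratR N ∧ φ' = ratPhi N :=
  ⟨fun h => h.unique, by rintro ⟨rfl, rfl⟩; exact isDecimationPair_ratR_ratPhi N n⟩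

/-! ### The formulas in `w = √z` -/

theorem chebT_algebraMap (k : ℤ) (r : Polynomial ℂ) :
    chebT k (algebraMap (Polynomial ℂ) (RatFunc ℂ) r) =
      algebraMap _ _ ((Polynomial.Chebyshev.T ℂ k).comp r) := by
  rw [chebT, ← Polynomial.Chebyshev.algebraMap_eval_T, ← Polynomial.Chebyshev.aeval_T (R := ℂ),
    Polynomial.comp_eq_aeval]

theorem chebU_algebraMap (k : ℤ) (r : Polynomial ℂ) :
    chebU k (algebraMap (Polynomial ℂ) (RatFunc ℂ) r) =
      algebraMap _ _ ((Polynomial.Chebyshev.U ℂ k).comp r) := by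
  rw [chebU, ← Polynomial.Chebyshev.algebraMap_eval_U, ← Polynomial.Chebyshev.aeval_U (R := ℂ),
    Polynomial.comp_eq_aeval]

theorem algebraMap_two : algebraMap (Polynomial ℂ) (RatFunc ℂ) 2 = 2 := by
  rw [← one_add_one_eq_two, map_add, map_one, one_add_one_eq_two]

theorem algebraMap_three : algebraMap (Polynomial ℂ) (RatFunc ℂ) 3 = 3 := by
  rw [← two_add_one_eq_three, map_add, map_one, algebraMap_two, two_add_one_eq_three]

theorem gPoly_comp_X_sq (N : ℕ) :
    2 * chebT N (1 - 2 * RatFunc.X ^ 2) + 2 * chebU (N - 1) (1 - 2 * RatFunc.X ^ 2) + 1 =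
      algebraMap (Polynomial ℂ) (RatFunc ℂ) ((gPoly N).comp (Polynomial.X ^ 2)) := by
  have e : (1 - 2 * RatFunc.X ^ 2 : RatFunc ℂ) =
      algebraMap (Polynomial ℂ) (RatFunc ℂ) (1 - 2 * Polynomial.X ^ 2) := by
    simp [algebraMap_two]
  rw [e, chebT_algebraMap, chebU_algebraMap]
  simp [algebraMap_two, gPoly, tPoly, uPoly, Polynomial.comp_assoc]

theorem chebT_X (k : ℤ) :
    chebT k RatFunc.X = algebraMap (Polynomial ℂ) (RatFunc ℂ) (Polynomial.Chebyshev.T ℂ k) := by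
  rw [← RatFunc.algebraMap_X, chebT_algebraMap, Polynomial.comp_X]

theorem chebU_X (k : ℤ) :
    chebU k RatFunc.X = algebraMap (Polynomial ℂ) (RatFunc ℂ) (Polynomial.Chebyshev.U ℂ k) := by
  rw [← RatFunc.algebraMap_X, chebU_algebraMap, Polynomial.comp_X]

theorem comp_X_sq_of_even {N : ℕ} (hN : Even N) :
    (qPoly N).comp (Polynomial.X ^ 2) = Polynomial.Chebyshev.T ℂ N ∧
      (pPoly N).comp (Polynomial.X ^ 2) = (Polynomial.X ^ 2 - 1) * Polynomial.X *
        Polynomial.Chebyshev.U ℂ (N - 1) :=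
  ⟨Polynomial.funext fun w => by simp [eval_qPoly_of_even hN],
    Polynomial.funext fun w => by simp [eval_pPoly_of_even hN]⟩

theorem comp_X_sq_of_odd {N : ℕ} (hN : ¬ Even N) :
    (qPoly N).comp (Polynomial.X ^ 2) = Polynomial.Chebyshev.U ℂ (N - 1) ∧
      (pPoly N).comp (Polynomial.X ^ 2) = Polynomial.X * Polynomial.Chebyshev.T ℂ N :=
  ⟨Polynomial.funext fun w => by simp [eval_qPoly_of_odd hN],
    Polynomial.funext fun w => by simp [eval_pPoly_of_odd hN]⟩

theorem atSq_ratR (N : ℕ) : atSq (ratR N) = formulaR N := by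
  rw [ratR, atSq_div _ (qPoly_ne_zero N), formulaR]
  simp only [gPoly_comp_X_sq, chebT_X, chebU_X]
  split_ifs with hN
  · obtain ⟨h1, h2⟩ := comp_X_sq_of_even hN
    simp [Polynomial.mul_comp, h1, h2]
  · obtain ⟨h1, h2⟩ := comp_X_sq_of_odd hN
    simp [Polynomial.mul_comp, h1, h2]

theorem atSq_ratPhi (N : ℕ) : atSq (ratPhi N) = formulaPhi N := by
  rw [ratPhi, atSq_div _ (mul_ne_zero (qPoly_sub_ne_zero N) (gPoly_ne_zero N)), formulaPhi]
  simp only [gPoly_comp_X_sq, chebT_X, chebU_X]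
  split_ifs with hN
  · obtain ⟨h1, h2⟩ := comp_X_sq_of_even hN
    simp [algebraMap_two, algebraMap_three, Polynomial.mul_comp, Polynomial.sub_comp, h1, h2, mul_assoc]
  · obtain ⟨h1, h2⟩ := comp_X_sq_of_odd hN
    simp [algebraMap_two, algebraMap_three, Polynomial.mul_comp, Polynomial.sub_comp, h1, h2, mul_assoc]

/-! ### Poles of `R` and zeros of `φ` -/

/-- At `-2` the sum `T_N + U_{N-1}` is an integer of absolute value at least `3`. -/
theorem chebyshev_neg_two (m : ℕ) : ∃ a b : ℕ, 1 ≤ b ∧ b + 3 ≤ a ∧ ∃ e : ℂ, (e = 1 ∨ e = -1) ∧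
    (Polynomial.Chebyshev.T ℂ (m + 2)).eval (-2) = e * a ∧
    (Polynomial.Chebyshev.U ℂ (m + 1)).eval (-2) = -e * b := by
  induction m with
  | zero =>
    refine ⟨7, 4, by norm_num, by norm_num, 1, Or.inl rfl, ?_, ?_⟩
    · rw [Nat.cast_zero, zero_add, Polynomial.Chebyshev.T_two]; norm_num
    · rw [Nat.cast_zero, zero_add, Polynomial.Chebyshev.U_one]; norm_num
  | succ m ih =>
    obtain ⟨a, b, h1, h2, e, he, hT, hU⟩ := ih
    have k1 := congrArg (Polynomial.eval (-2))
      (Polynomial.Chebyshev.T_eq_X_mul_T_sub_pol_U ℂ (m + 1))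
    have k2 := congrArg (Polynomial.eval (-2)) (Polynomial.Chebyshev.U_eq_X_mul_U_add_T ℂ (m + 1))
    simp only [Polynomial.eval_sub, Polynomial.eval_mul, Polynomial.eval_X, Polynomial.eval_add,
      Polynomial.eval_one, Polynomial.eval_pow] at k1 k2
    rw [show (m + 1 + 1 : ℤ) = m + 2 by ring, hT, hU] at k1 k2
    -- Multiplication by `2 + √3`: the pair satisfies `a + b√3 = (2 + √3)^(m + 2)`.
    refine ⟨2 * a + 3 * b, a + 2 * b, by omega, by omega, -e, ?_, ?_, ?_⟩
    · rcases he with rfl | rfl <;> simp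
    · push_cast
      rw [k1]; ring
    · push_cast
      rw [show (m + 1 + 1 : ℤ) = m + 2 by ring, k2]; ring

theorem eval_three_halves {N : ℕ} (hN : 1 < N) :
    (uPoly N).eval (3 / 2) + (tPoly N).eval (3 / 2) - 1 ≠ 0 ∧ (gPoly N).eval (3 / 2) ≠ 0 := by
  obtain ⟨m, rfl⟩ : ∃ m, N = m + 2 := ⟨N - 2, by omega⟩
  obtain ⟨a, b, h1, h2, e, he, hT, hU⟩ := chebyshev_neg_two m
  have hz : (1 : ℂ) - 2 * (3 / 2) = -2 := by norm_num
  obtain ⟨k, rfl⟩ : ∃ k, a = b + k := ⟨a - b, by omega⟩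
  rw [eval_gPoly, eval_tPoly, eval_uPoly, hz]
  push_cast
  rw [show (m + 2 - 1 : ℤ) = m + 1 by ring, hT, hU]
  push_cast
  rcases he with rfl | rfl
  · constructor <;> intro h
    · have : (k : ℂ) = (1 : ℕ) := by push_cast; linear_combination h
      have := Nat.cast_injective this
      omega
    · have : ((2 * k + 1 : ℕ) : ℂ) = (0 : ℕ) := by push_cast; linear_combination h
      have := Nat.cast_injective this
      omega
  · constructor <;> intro h
    · have : ((k + 1 : ℕ) : ℂ) = (0 : ℕ) := by push_cast; linear_combination -h
      have := Nat.cast_injective this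
      omega
    · have : ((2 * k : ℕ) : ℂ) = (1 : ℕ) := by push_cast; linear_combination -h
      have := Nat.cast_injective this
      omega

theorem isRoot_qPoly_iff {N : ℕ} [NeZero N] {c : ℂ} : (qPoly N).eval c = 0 ↔ c ∈ poleSet N :=
  ⟨mem_poleSet_of_eval_qPoly_eq_zero, fun h => (eval_of_mem_poleSet h).1⟩

theorem isCoprime_ratR (N : ℕ) [NeZero N] : IsCoprime (pPoly N * gPoly N) (qPoly N) := by
  rw [Polynomial.isCoprime_iff_aeval_ne_zero_of_isAlgClosed ℂ ℂ]
  intro c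
  simp only [Polynomial.coe_aeval_eq_eval]
  by_cases hc : (qPoly N).eval c = 0
  · obtain ⟨-, hp, hg, -⟩ := eval_of_mem_poleSet (isRoot_qPoly_iff.1 hc)
    exact Or.inl (by rw [Polynomial.eval_mul]; exact mul_ne_zero hp hg)
  · exact Or.inr hc

/-- At a root of `q` the denominator equals `-2pG`, which is nonzero there. The only other root of
the numerator is `3/2`, treated through `u (q - 2p) = q (u + t - 1)` and the values at `-2`. -/
theorem isCoprime_ratPhi {N : ℕ} [NeZero N] (hN : 1 < N) :
    IsCoprime ((3 - 2 * Polynomial.X) * qPoly N) ((qPoly N - 2 * pPoly N) * gPoly N) := by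
  rw [Polynomial.isCoprime_iff_aeval_ne_zero_of_isAlgClosed ℂ ℂ]
  intro c
  simp only [Polynomial.coe_aeval_eq_eval]
  by_cases hc : (qPoly N).eval c = 0
  · obtain ⟨-, hp, hg, -⟩ := eval_of_mem_poleSet (isRoot_qPoly_iff.1 hc)
    exact Or.inr (by simp [hc, hp, hg])
  by_cases h3 : 3 - 2 * c = 0
  · obtain rfl : c = 3 / 2 := by linear_combination -h3 / 2
    obtain ⟨hut, hg⟩ := eval_three_halves hN
    refine Or.inr ?_
    rw [Polynomial.eval_mul]
    refine mul_ne_zero ?_ hg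
    intro h
    simp only [Polynomial.eval_sub, Polynomial.eval_mul, Polynomial.eval_ofNat] at h
    have hrel := two_mul_u_mul_p (N := N) (show (3 / 2 : ℂ) ≠ 1 by norm_num)
    refine mul_ne_zero hut hc ?_
    linear_combination (uPoly N).eval (3 / 2) * h + hrel
  · exact Or.inl (by simp [hc, h3])

theorem isPole_ratR_iff {N : ℕ} [NeZero N] {c : ℂ} : IsPole (ratR N) c ↔ c ∈ poleSet N := by
  rw [IsPole, ratR, isRoot_iff_of_associated (denom_associated (qPoly_ne_zero N)
    (isCoprime_ratR N)), Polynomial.IsRoot.def, isRoot_qPoly_iff]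

theorem isSimplePole_ratR {N : ℕ} [NeZero N] {c : ℂ} (hc : c ∈ poleSet N) :
    IsSimplePole (ratR N) c := by
  have h0 : (qPoly N).rootMultiplicity c = 1 := by
    obtain ⟨hq, -, -, hd⟩ := eval_of_mem_poleSet hc
    refine le_antisymm ?_ ((Polynomial.rootMultiplicity_pos (qPoly_ne_zero N)).2 hq)
    by_contra h
    exact hd ((Polynomial.one_lt_rootMultiplicity_iff_isRoot (qPoly_ne_zero N)).1
      (not_le.1 h)).2
  have ha := denom_associated (qPoly_ne_zero N) (isCoprime_ratR N)
  refine le_antisymm ?_ ?_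
  · rw [← h0]
    exact Polynomial.rootMultiplicity_le_rootMultiplicity_of_dvd (qPoly_ne_zero N) ha.dvd c
  · exact (Polynomial.rootMultiplicity_pos (RatFunc.denom_ne_zero _)).2 (isPole_ratR_iff.2 hc)

theorem isZero_ratPhi_iff {N : ℕ} [NeZero N] (hN : 1 < N) {c : ℂ} :
    IsZero (ratPhi N) c ↔ c ∈ poleSet N ∪ {3 / 2} := by
  rw [IsZero, ratPhi, isRoot_iff_of_associated (num_associated
    (mul_ne_zero (qPoly_sub_ne_zero N) (gPoly_ne_zero N)) (isCoprime_ratPhi hN)),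
    Polynomial.IsRoot.def, Polynomial.eval_mul, mul_eq_zero, isRoot_qPoly_iff, or_comm,
    Set.mem_union, Set.mem_singleton_iff]
  have : (3 - 2 * Polynomial.X : Polynomial ℂ).eval c = 0 ↔ c = 3 / 2 := by
    simp only [Polynomial.eval_sub, Polynomial.eval_mul, Polynomial.eval_X,
      Polynomial.eval_ofNat]
    constructor
    · intro h; linear_combination -h / 2
    · rintro rfl; norm_num
  rw [this]

end Gasket

theorem theorem2 (N : ℕ) [NeZero N] :
    ∃ R φ : RatFunc ℂ,
      (∀ (n : ℕ) (R' φ' : RatFunc ℂ), Gasket.IsDecimationPair N n R' φ' ↔ R' = R ∧ φ' = φ) ∧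
      Gasket.atSq R = Gasket.formulaR N ∧
      Gasket.atSq φ = Gasket.formulaPhi N ∧
      (1 < N →
        {c | Gasket.IsPole R c} = Gasket.poleSet N ∧
        (∀ c ∈ Gasket.poleSet N, Gasket.IsSimplePole R c) ∧
        {c | Gasket.IsZero φ c} = Gasket.poleSet N ∪ {3 / 2}) :=
  ⟨Gasket.ratR N, Gasket.ratPhi N, fun n R' φ' => Gasket.isDecimationPair_iff N n R' φ',
    Gasket.atSq_ratR N, Gasket.atSq_ratPhi N, fun hN =>
      ⟨Set.ext fun _ => Gasket.isPole_ratR_iff, fun _ hc => Gasket.isSimplePole_ratR hc,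
        Set.ext fun _ => Gasket.isZero_ratPhi_iff hN⟩⟩
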